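/- Let $\mathbb{C}[z_1,\dots,z_k,z_1^*,\dots,z_k^*]$ carry the conjugation that conjugates coefficients and exchanges $z_j$ with $z_j^*$, and let $|z_j|^2=z_jz_j^*$. A $[p,n,k]$ complex orthogonal design (COD) is a $p\times n$ matrix $\mathcal O$ over this ring such that every nonzero entry is one of $\pm z_j,\pm z_j^*$ ($1\le j\le k$) and $\mathcal O^H\mathcal O=(|z_1|^2+\dots+|z_k|^2)I_n$; rows of zeros are allowed. A COD is of first type if there are no two distinct rows and two distinct columns, taken in any order, whose intersection is $\begin{pmatrix}\pm z_j&0\\0&\pm z_j^*\end{pmatrix}$ or $\begin{pmatrix}\pm z_j^*&0\\0&\pm z_j\end{pmatrix}$ for some $1\le j\le k$ (the signs being independent). Let $p,n,k$ be positive integers, and put $\binom{n}{i}=0$ for $i<0$. 1. If $n\not\equiv 0\pmod 4$, then a first type COD with parameters $[p,n,k]$ exists if and only if there are nonnegative integers $t_{-1},t_0,\dots,t_{\lfloor n/2\rfloor}$ such that $$p=\sum_{i=-1}^{\lfloor n/2\rfloor}t_i\left(\binom{n}{i-1}+\binom{n}{i+1}\right)\quad\text{and}\quad k=\sum_{i=-1}^{\lfloor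 n/2\rfloor}t_i\binom{n}{i}.$$ 2. If $n\equiv 0\pmod 4$, then a first type COD with parameters $[p,n,k]$ exists if and only if there are nonnegative integers $t_{-1},t_0,\dots,t_{n/2}$ such that $$p=\sum_{i=-1}^{n/2-1}t_i\left(\binom{n}{i-1}+\binom{n}{i+1}\right)+t_{n/2}\binom{n}{n/2-1}\quad\text{and}\quad k=\sum_{i=-1}^{n/2-1}t_i\binom{n}{i}+t_{n/2}\binom{n-1}{n/2-1}.$$ -/

import Mathlib

/-- The polynomial ring `ℂ[z₁, …, z_k, z₁*, …, z_k*]` in the indeterminates `z_j` (the generators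
`Sum.inl j`) and their formal conjugates `z_j*` (the generators `Sum.inr j`). -/
abbrev CODRing (k : ℕ) : Type := MvPolynomial (Fin k ⊕ Fin k) ℂ

namespace CODRing

/-- The indeterminate `z_j`. -/
noncomputable def z {k : ℕ} (j : Fin k) : CODRing k := MvPolynomial.X (Sum.inl j)

/-- The formal conjugate `z_j*`. -/
noncomputable def zs {k : ℕ} (j : Fin k) : CODRing k := MvPolynomial.X (Sum.inr j)

/-- Conjugation: complex conjugation of the coefficients, together with the exchange of `z_j`
and `z_j*`. -/
noncomputable def conj (k : ℕ) : CODRing k →+* CODRing k :=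
  (MvPolynomial.rename (Sum.swap : Fin k ⊕ Fin k → Fin k ⊕ Fin k)).toRingHom.comp
    (MvPolynomial.map (starRingEnd ℂ))

@[simp] theorem conj_z {k : ℕ} (j : Fin k) : conj k (z j) = zs j := by
  simp [conj, z, zs]

@[simp] theorem conj_zs {k : ℕ} (j : Fin k) : conj k (zs j) = z j := by
  simp [conj, z, zs]

end CODRing

/-- The Hermitian transpose `Oᴴ` of a matrix of polynomials in the `z_j` and `z_j*`. -/
noncomputable def codHermitian {p n k : ℕ} (O : Matrix (Fin p) (Fin n) (CODRing k)) :
    Matrix (Fin n) (Fin p) (CODRing k) :=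
  (O.map (CODRing.conj k)).transpose

/-- `O` is a `[p, n, k]` complex orthogonal design: every nonzero entry is one of
`±z_j, ±z_j*` and `Oᴴ O = (|z₁|² + ⋯ + |z_k|²) I`, where `|z_j|² = z_j z_j*`. -/
structure IsCOD {p n k : ℕ} (O : Matrix (Fin p) (Fin n) (CODRing k)) : Prop where
  entry : ∀ r c, O r c ≠ 0 →
    ∃ (j : Fin k) (ε : ℤˣ), O r c = ε • CODRing.z j ∨ O r c = ε • CODRing.zs j
  orthogonal : codHermitian O * O =
    (∑ j : Fin k, CODRing.z j * CODRing.zs j) • (1 : Matrix (Fin n) (Fin n) (CODRing k))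

/-- `O` is a first type complex orthogonal design: a COD for which no two rows and two columns,
taken in any order, meet in `(±z_j, 0; 0, ±z_j*)` or `(±z_j*, 0; 0, ±z_j)`. -/
structure IsFirstTypeCOD {p n k : ℕ} (O : Matrix (Fin p) (Fin n) (CODRing k)) : Prop where
  isCOD : IsCOD O
  firstType : ∀ (r s : Fin p) (c d : Fin n) (j : Fin k) (ε δ : ℤˣ), r ≠ s → c ≠ d →
    O.submatrix ![r, s] ![c, d] ≠ !![ε • CODRing.z j, 0; 0, δ • CODRing.zs j] ∧
    O.submatrix ![r, s] ![c, d] ≠ !![ε • CODRing.zs j, 0; 0, δ • CODRing.z j]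

/-- The binomial coefficient `n choose i` for an integer `i`; it is `0` for `i < 0`. -/
def intChoose (n : ℕ) (i : ℤ) : ℕ := if 0 ≤ i then n.choose i.toNat else 0

/-! Treat `z_j` and `z_j*` as two orientations of one variable. Orthogonality says that each column
contains exactly one of them, once, so the columns containing an oriented variable `v` form a set
whose complement belongs to the conjugate of `v`. For two columns it says that every pair of entries
in a row is cancelled by a unique partner row (the Alamouti condition). Together with the first type
condition this gives the rigid law `varSet_eq_insert`: if `v` stands in row `r` and column `c`, then
`v` occurs exactly in `c` and in the columns where `r` vanishes.

Hence rows vanishing exactly on `T` correspond to variables occurring exactly on `T ∪ {c}`, for any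
`c ∉ T`. Exchanging one column at a time, the number of variables occurring exactly on `S` depends
only on `w = |S|`; call it `N w`. Then `N (n - w) = N w`, and counting gives `2k = ∑ N w * C(n, w)`
and `2p = 2z + ∑ N w * (C(n, w-1) + C(n, w+1))`, with `z` the number of zero rows. Pairing `w` with
`n - w` gives the stated sums, with `z` as `t_{-1}`; for even `n` the middle weight contributes half
components.

If `n = 2m` with `m` odd, `N m` is even (`even_numVar`): moving `m` columns to the other `m` by
signed hops and then conjugating is a skew symmetric orthogonal operator on the variables occurring
exactly in the first `m` columns. So half components pair up unless `4 ∣ n`.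

Conversely, take rows `T`, variables `T ∪ {c}` and the fermionic sign of inserting `c` into `T`. The
Alamouti relation then holds up to `(-1)^(c+d)`, which is absorbed by signs attached to the
variables. For a half component this is possible because `n(n-1)/2` is even when `4 ∣ n`. -/

open MvPolynomial

/-- The combinatorial content of a first type complex orthogonal design: `A c r v` is the sign with
which the oriented variable `v` occurs in row `r` and column `c`, and `0` if it does not occur there;
`sw` is the conjugation of oriented variables. -/
structure SignDesign {n : ℕ} {P V : Type*} (sw : V → V) (A : Fin n → Matrix P V ℤ) : Prop where
  val : ∀ c r v, A c r v ≠ 0 → A c r v = 1 ∨ A c r v = -1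
  unique : ∀ {c r u v}, A c r u ≠ 0 → A c r v ≠ 0 → u = v
  col_unique : ∀ {c r s v}, A c r v ≠ 0 → A c s v ≠ 0 → r = s
  col_exists : ∀ c v, (∃ r, A c r v ≠ 0) ∨ ∃ r, A c r (sw v) ≠ 0
  col_not_both : ∀ {c r s v}, A c r v ≠ 0 → A c s (sw v) ≠ 0 → False
  alamouti : ∀ {c d r u v}, c ≠ d → A c r v ≠ 0 → A d r u ≠ 0 →
    ∃ s, A c s (sw u) ≠ 0 ∧ A d s (sw v) ≠ 0 ∧
      A c r v * A d r u = -(A c s (sw u) * A d s (sw v))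
  first : ∀ {c d r s v}, c ≠ d → A c r v ≠ 0 → A d s (sw v) ≠ 0 → ∃ u, A d r u ≠ 0

/-! ### From polynomial designs to sign patterns -/

section Extraction

variable {p n k : ℕ}

theorem X_ne_neg_X {τ : Type*} (u v : τ) : (X u : MvPolynomial τ ℂ) ≠ -X v := by
  intro h
  have := congrArg (eval fun _ => (1 : ℂ)) h
  simp at this
  norm_num [eq_neg_iff_add_eq_zero] at this

/-- The sign with which the oriented variable `v` occurs in row `r` and column `c` of `O`. -/
noncomputable def entrySign (O : Matrix (Fin p) (Fin n) (CODRing k)) (c : Fin n) :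
    Matrix (Fin p) (Fin k ⊕ Fin k) ℤ :=
  open Classical in fun r v => if O r c = X v then 1 else if O r c = -X v then -1 else 0

variable {O : Matrix (Fin p) (Fin n) (CODRing k)}

theorem entrySign_of_eq_X {r c v} (h : O r c = X v) (u) :
    entrySign O c r u = if u = v then 1 else 0 := by
  classical
  unfold entrySign
  rw [h]
  by_cases huv : u = v
  · simp [huv]
  · have : (X v : CODRing k) ≠ X u := fun h' => huv (X_injective h').symm
    simp [huv, this, X_ne_neg_X]

theorem entrySign_of_eq_neg_X {r c v} (h : O r c = -X v) (u) :
    entrySign O c r u = if u = v then -1 else 0 := by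
  classical
  unfold entrySign
  rw [h]
  by_cases huv : u = v
  · simp [huv, (X_ne_neg_X v v).symm]
  · have : (X v : CODRing k) ≠ X u := fun h' => huv (X_injective h').symm
    simp [huv, this, (X_ne_neg_X u v).symm]

theorem entrySign_of_eq_zero {r c} (h : O r c = 0) (u) : entrySign O c r u = 0 := by
  classical
  unfold entrySign
  have := X_ne_zero (R := ℂ) u
  rw [h]
  rw [if_neg this.symm, if_neg]
  intro h'
  exact this (neg_eq_zero.mp h'.symm)

theorem eq_of_entrySign_ne_zero {r c v} (h : entrySign O c r v ≠ 0) :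
    O r c = X v ∨ O r c = -X v := by
  classical
  unfold entrySign at h
  by_contra hc
  push Not at hc
  simp [hc.1, hc.2] at h

theorem IsCOD.entry_cases (hO : IsCOD O) (r c) :
    O r c = 0 ∨ (∃ v, O r c = X v) ∨ ∃ v, O r c = -X v := by
  by_cases h : O r c = 0
  · exact Or.inl h
  obtain ⟨j, ε, h | h⟩ := hO.entry r c h <;> rcases Int.units_eq_one_or ε with rfl | rfl
  · exact Or.inr (Or.inl ⟨Sum.inl j, by simpa [CODRing.z] using h⟩)
  · exact Or.inr (Or.inr ⟨Sum.inl j, by simpa [CODRing.z] using h⟩)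
  · exact Or.inr (Or.inl ⟨Sum.inr j, by simpa [CODRing.zs] using h⟩)
  · exact Or.inr (Or.inr ⟨Sum.inr j, by simpa [CODRing.zs] using h⟩)

theorem entrySign_val (c r v) (h : entrySign O c r v ≠ 0) :
    entrySign O c r v = 1 ∨ entrySign O c r v = -1 := by
  rcases eq_of_entrySign_ne_zero h with h | h
  · simp [entrySign_of_eq_X h]
  · simp [entrySign_of_eq_neg_X h]

theorem entrySign_unique {c r u v} (hu : entrySign O c r u ≠ 0) (hv : entrySign O c r v ≠ 0) :
    u = v := by
  rcases eq_of_entrySign_ne_zero hv with h | h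
  · rw [entrySign_of_eq_X h] at hu
    by_contra hc
    simp [hc] at hu
  · rw [entrySign_of_eq_neg_X h] at hu
    by_contra hc
    simp [hc] at hu

theorem IsCOD.exists_entrySign (hO : IsCOD O) {r c} (h : O r c ≠ 0) :
    ∃ v, entrySign O c r v ≠ 0 := by
  rcases hO.entry_cases r c with h' | ⟨v, h'⟩ | ⟨v, h'⟩
  · exact absurd h' h
  · exact ⟨v, by simp [entrySign_of_eq_X h']⟩
  · exact ⟨v, by simp [entrySign_of_eq_neg_X h']⟩

theorem IsCOD.eval_entry (hO : IsCOD O) (r c) (x : Fin k ⊕ Fin k → ℂ) :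
    eval x (O r c) = ∑ v, (entrySign O c r v : ℂ) * x v := by
  rcases hO.entry_cases r c with h | ⟨v, h⟩ | ⟨v, h⟩
  · simp [entrySign_of_eq_zero h, h]
  · simp [entrySign_of_eq_X h, h]
  · simp [entrySign_of_eq_neg_X h, h]

theorem IsCOD.eval_conj_entry (hO : IsCOD O) (r c) (x : Fin k ⊕ Fin k → ℂ) :
    eval x (CODRing.conj k (O r c)) = ∑ v, (entrySign O c r v : ℂ) * x v.swap := by
  rcases hO.entry_cases r c with h | ⟨v, h⟩ | ⟨v, h⟩
  · simp [entrySign_of_eq_zero h, h]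
  · simp [entrySign_of_eq_X h, h, CODRing.conj]
  · simp [entrySign_of_eq_neg_X h, h, CODRing.conj]

theorem IsCOD.eval_orthogonal (hO : IsCOD O) (c d) (x : Fin k ⊕ Fin k → ℂ) :
    ∑ r, (∑ v, (entrySign O c r v : ℂ) * x v.swap) * (∑ v, (entrySign O d r v : ℂ) * x v) =
      if c = d then ∑ j, x (Sum.inl j) * x (Sum.inr j) else 0 := by
  have h := congrArg (eval x) (congrFun (congrFun hO.orthogonal c) d)
  simp only [Matrix.mul_apply, codHermitian, Matrix.transpose_apply, Matrix.map_apply, map_sum,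
    map_mul, hO.eval_entry, hO.eval_conj_entry] at h
  rw [h]
  by_cases hcd : c = d
  · simp [hcd, CODRing.z, CODRing.zs]
  · simp [hcd]

theorem sum_mul_single_swap (f : Fin k ⊕ Fin k → ℂ) (a : Fin k ⊕ Fin k) :
    ∑ v, f v * (Pi.single a (1 : ℂ) : Fin k ⊕ Fin k → ℂ) v.swap = f a.swap := by
  rw [Finset.sum_eq_single a.swap]
  · simp
  · intro b _ hb
    rw [Pi.single_eq_of_ne, mul_zero]
    rintro rfl
    simp at hb
  · simp

theorem sum_mul_single (f : Fin k ⊕ Fin k → ℂ) (a : Fin k ⊕ Fin k) :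
    ∑ v, f v * (Pi.single a (1 : ℂ) : Fin k ⊕ Fin k → ℂ) v = f a := by
  rw [Finset.sum_eq_single a]
  · simp
  · intro b _ hb
    rw [Pi.single_eq_of_ne hb, mul_zero]
  · simp

/-- Polarization: evaluating at the unit vectors of `a` and `b` and at their sum isolates the
coefficient of the monomial `x_a x_b` in an off-diagonal entry of `Oᴴ O`. -/
theorem IsCOD.sum_entrySign_mul (hO : IsCOD O) {c d} (hcd : c ≠ d) (a b) :
    ∑ r, (entrySign O c r a.swap * entrySign O d r b +
      entrySign O c r b.swap * entrySign O d r a) = 0 := by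
  have h1 := hO.eval_orthogonal c d (Pi.single a 1)
  have h2 := hO.eval_orthogonal c d (Pi.single b 1)
  have h3 := hO.eval_orthogonal c d (Pi.single a 1 + Pi.single b 1)
  simp only [Pi.add_apply, mul_add, Finset.sum_add_distrib, sum_mul_single_swap, sum_mul_single,
    if_neg hcd, add_mul] at h1 h2 h3
  have h : (∑ r, (entrySign O c r a.swap * entrySign O d r b +
      entrySign O c r b.swap * entrySign O d r a : ℂ)) = 0 := by
    rw [Finset.sum_add_distrib]
    linear_combination h3 - h1 - h2
  exact_mod_cast h

/-- At the sum of the unit vectors of `v` and its conjugate, each entry agrees with its conjugate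
and `∑ z_j z_j*` equals `1`. As the summands are integer squares, a single row can contribute. -/
theorem IsCOD.sum_entrySign_sq (hO : IsCOD O) (c) (v) :
    ∑ r, (entrySign O c r v + entrySign O c r v.swap) ^ 2 = 1 := by
  have h := hO.eval_orthogonal c c (Pi.single v 1 + Pi.single v.swap 1)
  simp only [Pi.add_apply, mul_add, Finset.sum_add_distrib, sum_mul_single_swap, sum_mul_single,
    if_true, add_mul, Sum.swap_swap] at h
  have h' : (∑ r, (entrySign O c r v + entrySign O c r v.swap : ℂ) ^ 2) = 1 := by
    have hq : ∀ r, (entrySign O c r v + entrySign O c r v.swap : ℂ) ^ 2 =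
        entrySign O c r v * entrySign O c r v + entrySign O c r v * entrySign O c r v.swap +
        (entrySign O c r v.swap * entrySign O c r v +
          entrySign O c r v.swap * entrySign O c r v.swap) := fun r => by ring
    simp only [hq, Finset.sum_add_distrib]
    refine (Eq.trans ?_ h).trans ?_
    · ring
    · rcases v with i | i <;> simp [Pi.single_apply]
  exact_mod_cast h'

theorem entrySign_add_swap_sq {r c v} (h : entrySign O c r v ≠ 0 ∨ entrySign O c r v.swap ≠ 0) :
    (entrySign O c r v + entrySign O c r v.swap) ^ 2 = 1 := by
  have hne : v ≠ v.swap := by rcases v with i | i <;> simp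
  by_cases hv : entrySign O c r v = 0
  · rcases entrySign_val _ _ _ (h.resolve_left (not_not.mpr hv)) with h' | h' <;> simp [hv, h']
  · have hs : entrySign O c r v.swap = 0 := by
      by_contra hs
      exact hne (entrySign_unique hv hs)
    rcases entrySign_val _ _ _ hv with h' | h' <;> simp [hs, h']

theorem IsCOD.row_unique (hO : IsCOD O) {r s c v}
    (hr : entrySign O c r v ≠ 0 ∨ entrySign O c r v.swap ≠ 0)
    (hs : entrySign O c s v ≠ 0 ∨ entrySign O c s v.swap ≠ 0) : r = s := by
  by_contra hrs
  have h := hO.sum_entrySign_sq c v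
  have h2 : ∑ x ∈ {r, s}, (entrySign O c x v + entrySign O c x v.swap) ^ 2 ≤
      ∑ x, (entrySign O c x v + entrySign O c x v.swap) ^ 2 :=
    Finset.sum_le_sum_of_subset_of_nonneg (Finset.subset_univ _) fun _ _ _ => sq_nonneg _
  rw [Finset.sum_pair hrs, entrySign_add_swap_sq hr, entrySign_add_swap_sq hs, h] at h2
  norm_num at h2

/-- The monomial `v* u` produced by row `r` must cancel. The only other way to produce it is to have
`u*` in column `c` and `v*` in column `d`, and a column contains each variable only once. -/
theorem IsCOD.exists_alamouti (hO : IsCOD O) {c d r u v} (hcd : c ≠ d)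
    (hv : entrySign O c r v ≠ 0) (hu : entrySign O d r u ≠ 0) :
    ∃ s, entrySign O c s u.swap ≠ 0 ∧ entrySign O d s v.swap ≠ 0 ∧
      entrySign O c r v * entrySign O d r u =
        -(entrySign O c s u.swap * entrySign O d s v.swap) := by
  have h := hO.sum_entrySign_mul hcd v.swap u
  simp only [Sum.swap_swap, Finset.sum_add_distrib] at h
  rw [Finset.sum_eq_single r] at h
  · have hne : ∑ x, entrySign O c x u.swap * entrySign O d x v.swap ≠ 0 := by
      intro h0
      rw [h0, add_zero] at h
      exact mul_ne_zero hv hu h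
    obtain ⟨s, -, hs⟩ := Finset.exists_ne_zero_of_sum_ne_zero hne
    refine ⟨s, left_ne_zero_of_mul hs, right_ne_zero_of_mul hs, ?_⟩
    rw [Finset.sum_eq_single s] at h
    · linarith
    · intro x _ hx
      by_contra h0
      exact hx (hO.row_unique (Or.inl (left_ne_zero_of_mul h0)) (Or.inl (left_ne_zero_of_mul hs)))
    · simp
  · intro x _ hx
    by_contra h0
    exact hx (hO.row_unique (Or.inl (left_ne_zero_of_mul h0)) (Or.inl hv))
  · simp

theorem IsCOD.entrySign_swap_eq_zero (hO : IsCOD O) {c r s v} (hr : entrySign O c r v ≠ 0) :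
    entrySign O c s v.swap = 0 := by
  by_contra hs
  obtain rfl := hO.row_unique (Or.inl hr) (Or.inr hs)
  have := entrySign_unique hr hs
  rcases v with i | i <;> simp at this

theorem exists_units_eq {r : Fin p} {c : Fin n} {v} (h : entrySign O c r v ≠ 0) :
    ∃ ε : ℤˣ, O r c = ε • X v := by
  rcases eq_of_entrySign_ne_zero h with h | h
  · exact ⟨1, by simpa using h⟩
  · exact ⟨-1, by simpa using h⟩

theorem IsFirstTypeCOD.signDesign (hO : IsFirstTypeCOD O) :
    SignDesign Sum.swap (entrySign O) where
  val := entrySign_val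
  unique := entrySign_unique
  col_unique hr hs := hO.isCOD.row_unique (Or.inl hr) (Or.inl hs)
  col_exists c v := by
    have hne : ∑ r, (entrySign O c r v + entrySign O c r v.swap) ^ 2 ≠ 0 := by
      simp [hO.isCOD.sum_entrySign_sq c v]
    obtain ⟨r, -, hr⟩ := Finset.exists_ne_zero_of_sum_ne_zero hne
    by_cases hv : entrySign O c r v = 0
    · exact Or.inr ⟨r, fun h => hr (by simp [hv, h])⟩
    · exact Or.inl ⟨r, hv⟩
  col_not_both hr hs := hs (hO.isCOD.entrySign_swap_eq_zero hr)
  alamouti := hO.isCOD.exists_alamouti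
  first := by
    intro c d r s v hcd hr hs
    by_contra hno
    have hrd : O r d = 0 := by
      by_contra h0
      exact hno (hO.isCOD.exists_entrySign h0)
    have hrs : r ≠ s := by
      rintro rfl
      exact hno ⟨_, hs⟩
    -- An entry at `(s, c)` would have an Alamouti partner row containing `v` in column `c`; that
    -- row is `r`, so `(r, d)` would be nonzero.
    have hsc : O s c = 0 := by
      by_contra h0
      obtain ⟨u, hu⟩ := hO.isCOD.exists_entrySign h0
      obtain ⟨s', h1, h2, -⟩ := hO.isCOD.exists_alamouti hcd.symm hs hu
      rw [Sum.swap_swap] at h2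
      obtain rfl := hO.isCOD.row_unique (Or.inl hr) (Or.inl h2)
      exact hno ⟨_, h1⟩
    obtain ⟨ε, hε⟩ := exists_units_eq hr
    obtain ⟨δ, hδ⟩ := exists_units_eq hs
    rcases v with j | j
    · refine (hO.firstType r s c d j ε δ hrs hcd).1 ?_
      ext i i'
      fin_cases i <;> fin_cases i' <;> simp [hε, hδ, hrd, hsc, CODRing.z, CODRing.zs]
    · refine (hO.firstType r s c d j ε δ hrs hcd).2 ?_
      ext i i'
      fin_cases i <;> fin_cases i' <;> simp [hε, hδ, hrd, hsc, CODRing.z, CODRing.zs]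

end Extraction

/-! ### From sign patterns back to polynomial designs -/

section Realization

theorem SignDesign.reindex {n : ℕ} {P P' V V' : Type*} {sw : V → V} {sw' : V' → V'}
    {A : Fin n → Matrix P V ℤ} (hA : SignDesign sw A) (e : P' ≃ P) (f : V' ≃ V)
    (hf : ∀ v, f (sw' v) = sw (f v)) : SignDesign sw' fun c => (A c).submatrix e f where
  val c r v := hA.val c (e r) (f v)
  unique h h' := f.injective (hA.unique h h')
  col_unique h h' := e.injective (hA.col_unique h h')
  col_exists c v := by
    refine (hA.col_exists c (f v)).imp ?_ ?_
    · rintro ⟨r, hr⟩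
      exact ⟨e.symm r, by simpa using hr⟩
    · rintro ⟨r, hr⟩
      exact ⟨e.symm r, by simpa [hf] using hr⟩
  col_not_both h h' := hA.col_not_both h (by simpa [hf] using h')
  alamouti hcd h h' := by
    obtain ⟨s, hs⟩ := hA.alamouti hcd h h'
    exact ⟨e.symm s, by simpa [hf] using hs⟩
  first hcd h h' := by
    obtain ⟨u, hu⟩ := hA.first hcd h (by simpa [hf] using h')
    exact ⟨f.symm u, by simpa using hu⟩

/-- This is the symmetrized coefficient of `x_a x_b` in entry `(c, d)` of `Oᴴ O`. For `c ≠ d` a row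
and its Alamouti partner cancel; for `c = d` only a variable and its conjugate can contribute,
through the one row containing either. -/
theorem SignDesign.sum_mul {n : ℕ} {P V : Type*} [Fintype P] [DecidableEq V] {sw : V → V}
    (hsw : Function.Involutive sw) {A : Fin n → Matrix P V ℤ} (hA : SignDesign sw A)
    (c d : Fin n) (a b : V) :
    ∑ r, (A c r (sw a) * A d r b + A c r (sw b) * A d r a) =
      if c = d ∧ b = sw a then 1 else 0 := by
  have hone : ∀ c r v, A c r v ≠ 0 → A c r v * A c r v = 1 := by
    intro c r v h
    rcases hA.val c r v h with h | h <;> simp [h]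
  by_cases hcd : c = d
  · subst hcd
    by_cases hb : b = sw a
    · subst hb
      have key : ∀ v, (∃ r, A c r v ≠ 0) →
          ∑ r, (A c r (sw v) * A c r (sw v) + A c r v * A c r v) = 1 := by
        rintro v ⟨r, hr⟩
        have hs : ∀ x, A c x (sw v) = 0 := fun x => by
          by_contra hx
          exact hA.col_not_both hr hx
        rw [Finset.sum_eq_single r]
        · simp [hs, hone c r v hr]
        · intro x _ hx
          have : A c x v = 0 := by
            by_contra h0
            exact hx (hA.col_unique h0 hr)
          simp [hs, this]
        · simp
      simp only [hsw a, and_self, if_true]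
      rcases hA.col_exists c a with h | h
      · exact key a h
      · have := key (sw a) h
        rw [hsw a] at this
        rw [← this]
        exact Finset.sum_congr rfl fun r _ => add_comm _ _
    · rw [if_neg fun h => hb h.2]
      refine Finset.sum_eq_zero fun r _ => ?_
      have h1 : A c r (sw a) * A c r b = 0 := by
        by_contra h0
        exact hb (hA.unique (left_ne_zero_of_mul h0) (right_ne_zero_of_mul h0)).symm
      have h2 : A c r (sw b) * A c r a = 0 := by
        by_contra h0
        apply hb
        rw [← hA.unique (left_ne_zero_of_mul h0) (right_ne_zero_of_mul h0), hsw b]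
      simp [h1, h2]
  · rw [if_neg fun h => hcd h.1]
    have key : ∀ a b, (∃ r, A c r (sw a) * A d r b ≠ 0) →
        ∑ r, (A c r (sw a) * A d r b + A c r (sw b) * A d r a) = 0 := by
      rintro a b ⟨r, hr⟩
      obtain ⟨s, h1, h2, h3⟩ :=
        hA.alamouti hcd (left_ne_zero_of_mul hr) (right_ne_zero_of_mul hr)
      rw [hsw a] at h2 h3
      rw [Finset.sum_add_distrib, Finset.sum_eq_single r, Finset.sum_eq_single s, h3]
      · simp
      · intro x _ hx
        by_contra h0
        exact hx (hA.col_unique (left_ne_zero_of_mul h0) h1)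
      · simp
      · intro x _ hx
        by_contra h0
        exact hx (hA.col_unique (left_ne_zero_of_mul h0) (left_ne_zero_of_mul hr))
      · simp
    by_cases h : ∃ r, A c r (sw a) * A d r b ≠ 0
    · exact key a b h
    · by_cases h' : ∃ r, A c r (sw b) * A d r a ≠ 0
      · rw [← key b a h']
        exact Finset.sum_congr rfl fun r _ => add_comm _ _
      · push Not at h h'
        exact Finset.sum_eq_zero fun r _ => by rw [h r, h' r, add_zero]

variable {p n k : ℕ}

/-- The matrix of polynomials with the prescribed signs of oriented variables. -/
noncomputable def designMatrix (A : Fin n → Matrix (Fin p) (Fin k ⊕ Fin k) ℤ) :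
    Matrix (Fin p) (Fin n) (CODRing k) :=
  fun r c => ∑ v, (A c r v : CODRing k) * X v

variable {A : Fin n → Matrix (Fin p) (Fin k ⊕ Fin k) ℤ}

theorem SignDesign.designMatrix_eq (hA : SignDesign Sum.swap A) {c r v} (h : A c r v ≠ 0) :
    designMatrix A r c = (A c r v : CODRing k) * X v := by
  unfold designMatrix
  refine Finset.sum_eq_single v (fun u _ hu => ?_) (by simp)
  have : A c r u = 0 := by
    by_contra h0
    exact hu (hA.unique h0 h)
  simp [this]

theorem designMatrix_eq_zero {c r} (h : ∀ v, A c r v = 0) : designMatrix A r c = 0 := by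
  simp [designMatrix, h]

theorem SignDesign.designMatrix_cases (hA : SignDesign Sum.swap A) {c r v} (h : A c r v ≠ 0) :
    designMatrix A r c = X v ∨ designMatrix A r c = -X v := by
  rw [hA.designMatrix_eq h]
  rcases hA.val c r v h with h | h <;> simp [h]

theorem SignDesign.ne_zero_of_designMatrix (hA : SignDesign Sum.swap A) {c r v} {ε : ℤˣ}
    (h : designMatrix A r c = ε • X v) : A c r v ≠ 0 := by
  have h' : designMatrix A r c = X v ∨ designMatrix A r c = -X v := by
    rcases Int.units_eq_one_or ε with rfl | rfl
    · exact Or.inl (by simpa using h)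
    · exact Or.inr (by simpa using h)
  by_cases h0 : ∀ u, A c r u = 0
  · rw [designMatrix_eq_zero h0] at h'
    have := X_ne_zero (R := ℂ) v
    rcases h' with h' | h'
    · exact absurd h'.symm this
    · exact absurd (neg_eq_zero.mp h'.symm) this
  · push Not at h0
    obtain ⟨u, hu⟩ := h0
    suffices u = v by rwa [← this]
    rcases hA.designMatrix_cases hu with h1 | h1 <;> rw [h1] at h' <;> rcases h' with h' | h'
    · exact X_injective h'
    · exact absurd h' (X_ne_neg_X u v)
    · exact absurd h'.symm (X_ne_neg_X v u)
    · exact X_injective (neg_injective h')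

theorem conj_designMatrix (r c) :
    CODRing.conj k (designMatrix A r c) = ∑ v, (A c r v.swap : CODRing k) * X v := by
  have h : ∀ v, CODRing.conj k (X v) = X v.swap := fun v => by simp [CODRing.conj]
  simp only [designMatrix, map_sum, map_mul, map_intCast, h]
  rw [← Equiv.sum_comp (Equiv.sumComm (Fin k) (Fin k))]
  simp

theorem SignDesign.orthogonal (hA : SignDesign Sum.swap A) :
    codHermitian (designMatrix A) * designMatrix A =
      (∑ j : Fin k, CODRing.z j * CODRing.zs j) • (1 : Matrix (Fin n) (Fin n) (CODRing k)) := by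
  ext1 c d
  have hL : (codHermitian (designMatrix A) * designMatrix A) c d =
      ∑ a, ∑ b, (∑ r, A c r a.swap * A d r b : ℤ) * (X a * X b : CODRing k) := by
    simp only [Matrix.mul_apply, codHermitian, Matrix.transpose_apply, Matrix.map_apply,
      conj_designMatrix]
    simp only [designMatrix, Finset.sum_mul_sum]
    simp only [Int.cast_sum, Finset.sum_mul]
    rw [Finset.sum_comm]
    refine Finset.sum_congr rfl fun a _ => ?_
    rw [Finset.sum_comm]
    refine Finset.sum_congr rfl fun b _ => Finset.sum_congr rfl fun r _ => ?_
    push_cast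
    ring
  have hR : (∑ a, ∑ b, (∑ r, A c r a.swap * A d r b : ℤ) * (X a * X b : CODRing k)) =
      ∑ a, ∑ b, (∑ r, A c r b.swap * A d r a : ℤ) * (X a * X b : CODRing k) := by
    rw [Finset.sum_comm]
    refine Finset.sum_congr rfl fun b _ => Finset.sum_congr rfl fun a _ => ?_
    rw [mul_comm (X a)]
  -- Doubling the double sum and exchanging `a` and `b` in one copy makes its coefficients
  -- symmetric, so that `sum_mul` applies.
  have h2 : (2 : CODRing k) * (codHermitian (designMatrix A) * designMatrix A) c d =
      2 * ((∑ j : Fin k, CODRing.z j * CODRing.zs j) •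
        (1 : Matrix (Fin n) (Fin n) (CODRing k))) c d := by
    rw [two_mul]
    nth_rewrite 2 [hL]
    rw [hR, hL, ← Finset.sum_add_distrib]
    simp only [← Finset.sum_add_distrib, ← add_mul, ← Int.cast_add]
    simp only [hA.sum_mul Sum.swap_swap]
    by_cases hcd : c = d
    · subst hcd
      simp [CODRing.z, CODRing.zs, mul_comm, two_mul]
    · simp [hcd]
  exact mul_left_cancel₀ two_ne_zero h2

theorem SignDesign.isFirstTypeCOD (hA : SignDesign Sum.swap A) :
    IsFirstTypeCOD (designMatrix A) where
  isCOD :=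
    { entry := by
        intro r c h
        have : ∃ v, A c r v ≠ 0 := by
          by_contra h0
          push Not at h0
          exact h (designMatrix_eq_zero h0)
        obtain ⟨v, hv⟩ := this
        rcases v with j | j
        · refine ⟨j, ?_⟩
          rcases hA.designMatrix_cases hv with h | h
          · exact ⟨1, Or.inl (by simpa [CODRing.z] using h)⟩
          · exact ⟨-1, Or.inl (by simpa [CODRing.z] using h)⟩
        · refine ⟨j, ?_⟩
          rcases hA.designMatrix_cases hv with h | h
          · exact ⟨1, Or.inr (by simpa [CODRing.zs] using h)⟩
          · exact ⟨-1, Or.inr (by simpa [CODRing.zs] using h)⟩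
      orthogonal := hA.orthogonal }
  firstType := by
    have key : ∀ (r s : Fin p) (c d : Fin n) (v : Fin k ⊕ Fin k) (ε δ : ℤˣ), c ≠ d →
        (designMatrix A).submatrix ![r, s] ![c, d] ≠ !![ε • X v, 0; 0, δ • X v.swap] := by
      intro r s c d v ε δ hcd h
      have h00 : designMatrix A r c = ε • X v := by simpa using congrFun (congrFun h 0) 0
      have h11 : designMatrix A s d = δ • X v.swap := by simpa using congrFun (congrFun h 1) 1
      have h01 : designMatrix A r d = 0 := by simpa using congrFun (congrFun h 0) 1
      obtain ⟨u, hu⟩ := hA.first hcd (hA.ne_zero_of_designMatrix h00)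
        (hA.ne_zero_of_designMatrix h11)
      have hX := X_ne_zero (R := ℂ) u
      rcases hA.designMatrix_cases hu with h' | h' <;> rw [h01] at h'
      · exact hX h'.symm
      · exact hX (neg_eq_zero.mp h'.symm)
    intro r s c d j ε δ _ hcd
    exact ⟨key r s c d (Sum.inl j) ε δ hcd, key r s c d (Sum.inr j) ε δ hcd⟩

theorem exists_isFirstTypeCOD_of_signDesign {P V : Type*} {sw : V → V}
    {A : Fin n → Matrix P V ℤ} (hA : SignDesign sw A) (e : Fin p ≃ P)
    (f : Fin k ⊕ Fin k ≃ V) (hf : ∀ v, f v.swap = sw (f v)) :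
    ∃ O : Matrix (Fin p) (Fin n) (CODRing k), IsFirstTypeCOD O :=
  ⟨_, (hA.reindex e f hf).isFirstTypeCOD⟩

end Realization

/-! ### Column sets of variables and rows, and their numbers -/

section Counting

variable {n : ℕ} {P V : Type*} {sw : V → V} {A : Fin n → Matrix P V ℤ}

open Classical in
/-- The columns in which the oriented variable `v` occurs. -/
noncomputable def varSet (A : Fin n → Matrix P V ℤ) (v : V) : Finset (Fin n) :=
  {c | ∃ r, A c r v ≠ 0}

open Classical in
/-- The columns in which row `r` vanishes. -/
noncomputable def zeroSet (A : Fin n → Matrix P V ℤ) (r : P) : Finset (Fin n) :=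
  {c | ∀ v, A c r v = 0}

theorem mem_varSet {v c} : c ∈ varSet A v ↔ ∃ r, A c r v ≠ 0 := by simp [varSet]

theorem mem_zeroSet {r c} : c ∈ zeroSet A r ↔ ∀ v, A c r v = 0 := by simp [zeroSet]

theorem notMem_zeroSet {r c} : c ∉ zeroSet A r ↔ ∃ v, A c r v ≠ 0 := by
  rw [mem_zeroSet]
  push Not
  rfl

theorem SignDesign.mem_varSet_sw (hA : SignDesign sw A) {v c} :
    c ∈ varSet A (sw v) ↔ c ∉ varSet A v := by
  constructor
  · intro h h'
    obtain ⟨s, hs⟩ := mem_varSet.mp h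
    obtain ⟨r, hr⟩ := mem_varSet.mp h'
    exact hA.col_not_both hr hs
  · intro h
    exact mem_varSet.mpr ((hA.col_exists c v).resolve_left fun h' => h (mem_varSet.mpr h'))

theorem SignDesign.varSet_sw (hA : SignDesign sw A) (v : V) :
    varSet A (sw v) = (varSet A v)ᶜ := by
  ext c
  rw [hA.mem_varSet_sw, Finset.mem_compl]

/-- If row `r` has an entry in column `d`, the Alamouti partner row puts the conjugate of `v` into
`d`. The converse is precisely the first type condition. -/
theorem SignDesign.notMem_zeroSet_iff (hA : SignDesign sw A) {c d r v} (hcd : c ≠ d)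
    (h : A c r v ≠ 0) : d ∉ zeroSet A r ↔ d ∉ varSet A v := by
  rw [notMem_zeroSet]
  constructor
  · rintro ⟨u, hu⟩
    obtain ⟨s, -, hs, -⟩ := hA.alamouti hcd h hu
    exact hA.mem_varSet_sw.mp (mem_varSet.mpr ⟨s, hs⟩)
  · intro hd
    obtain ⟨s, hs⟩ := mem_varSet.mp (hA.mem_varSet_sw.mpr hd)
    exact hA.first hcd h hs

theorem SignDesign.varSet_eq_insert (hA : SignDesign sw A) {c r v} (h : A c r v ≠ 0) :
    varSet A v = insert c (zeroSet A r) := by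
  ext d
  by_cases hd : c = d
  · subst hd
    simpa using mem_varSet.mpr ⟨r, h⟩
  · rw [Finset.mem_insert, or_iff_right (Ne.symm hd)]
    exact not_iff_not.mp (hA.notMem_zeroSet_iff hd h).symm

open Classical in
/-- The number of oriented variables that occur exactly in the columns `S`. -/
noncomputable def numVar [Fintype V] (A : Fin n → Matrix P V ℤ) (S : Finset (Fin n)) : ℕ :=
  Finset.card {v | varSet A v = S}

open Classical in
/-- The number of rows that vanish exactly in the columns `T`. -/
noncomputable def numRow [Fintype P] (A : Fin n → Matrix P V ℤ) (T : Finset (Fin n)) : ℕ :=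
  Finset.card {r | zeroSet A r = T}

/-- Sending a row to its entry in column `c` is a bijection, by `varSet_eq_insert`. Since `c` is any
column outside `T`, this links different column sets of the same size. -/
theorem SignDesign.numRow_eq [Fintype P] [Fintype V] (hA : SignDesign sw A) {c : Fin n}
    {T : Finset (Fin n)} (hc : c ∉ T) : numRow A T = numVar A (insert c T) := by
  classical
  have hex : ∀ r ∈ ({r | zeroSet A r = T} : Finset P), ∃ v, A c r v ≠ 0 := by
    intro r hr
    rw [Finset.mem_filter_univ] at hr
    exact notMem_zeroSet.mp (hr ▸ hc)
  choose f hf using hex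
  refine Finset.card_bij f ?_ ?_ ?_
  · intro r hr
    have h := hA.varSet_eq_insert (hf r hr)
    rw [Finset.mem_filter_univ] at hr ⊢
    rw [h, hr]
  · intro r hr s hs hrs
    have h := hf s hs
    rw [← hrs] at h
    exact hA.col_unique (hf r hr) h
  · intro v hv
    rw [Finset.mem_filter_univ] at hv
    obtain ⟨r, hr⟩ := mem_varSet.mp (hv ▸ Finset.mem_insert_self c T : c ∈ varSet A v)
    have hT : zeroSet A r = T := by
      have h := hA.varSet_eq_insert hr
      rw [hv] at h
      have h' := congrArg (fun s => s.erase c) h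
      simp only [Finset.erase_insert hc] at h'
      rw [h', Finset.erase_insert (notMem_zeroSet.mpr ⟨v, hr⟩)]
    have hrT : r ∈ ({r | zeroSet A r = T} : Finset P) := by simpa using hT
    exact ⟨r, hrT, hA.unique (hf r hrT) hr⟩

/-- Both `S` and `S \ {c} ∪ {d}` have as many variables as there are rows vanishing exactly on `S \
{c}`. Such exchanges turn `S` into `S'`. -/
theorem SignDesign.numVar_eq_of_card_eq [Fintype P] [Fintype V] (hA : SignDesign sw A)
    {S S' : Finset (Fin n)} (h : S.card = S'.card) : numVar A S = numVar A S' := by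
  induction hm : (S \ S').card generalizing S with
  | zero =>
    rw [Finset.card_eq_zero, Finset.sdiff_eq_empty_iff_subset] at hm
    rw [Finset.eq_of_subset_of_card_le hm h.ge]
  | succ m ih =>
    have h1 : (S \ S').Nonempty := by
      rw [← Finset.card_pos]
      omega
    have h2 : (S' \ S).Nonempty := by
      rw [← Finset.card_pos, ← Finset.card_sdiff_comm h]
      omega
    obtain ⟨c, hc⟩ := h1
    obtain ⟨d, hd⟩ := h2
    rw [Finset.mem_sdiff] at hc hd
    have hdc : d ∉ S.erase c := fun h => hd.2 (Finset.mem_of_mem_erase h)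
    have e1 : numVar A S = numVar A (insert d (S.erase c)) := by
      rw [← hA.numRow_eq hdc, hA.numRow_eq (Finset.notMem_erase c S), Finset.insert_erase hc.1]
    rw [e1]
    refine ih ?_ ?_
    · rw [Finset.card_insert_of_notMem hdc, Finset.card_erase_add_one hc.1, h]
    · have : insert d (S.erase c) \ S' = (S \ S').erase c := by
        ext x
        simp only [Finset.mem_sdiff, Finset.mem_insert, Finset.mem_erase]
        constructor
        · rintro ⟨rfl | hx, hx'⟩
          · exact absurd hd.1 hx'
          · exact ⟨hx.1, hx.2, hx'⟩
        · rintro ⟨hx, hx', hx''⟩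
          exact ⟨Or.inr ⟨hx, hx'⟩, hx''⟩
      rw [this, Finset.card_erase_of_mem (Finset.mem_sdiff.mpr hc), hm]
      rfl

/-- The first `w` columns. -/
def initialCols (n w : ℕ) : Finset (Fin n) := {c | (c : ℕ) < w}

theorem card_initialCols {n w : ℕ} (h : w ≤ n) : (initialCols n w).card = w := by
  rw [initialCols, Fin.card_filter_val_lt, min_eq_right h]

theorem SignDesign.numVar_eq [Fintype P] [Fintype V] (hA : SignDesign sw A)
    (S : Finset (Fin n)) : numVar A S = numVar A (initialCols n S.card) :=
  hA.numVar_eq_of_card_eq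
    (card_initialCols (by simpa using Finset.card_le_univ S)).symm

theorem SignDesign.numVar_compl [Fintype P] [Fintype V] (hsw : Function.Involutive sw)
    (hA : SignDesign sw A) (S : Finset (Fin n)) : numVar A Sᶜ = numVar A S := by
  classical
  refine Finset.card_nbij' sw sw ?_ ?_ (fun v _ => hsw v) (fun v _ => hsw v)
  · intro v hv
    simp only [Finset.coe_filter, Finset.mem_univ, true_and, Set.mem_ofPred_eq] at hv ⊢
    rw [hA.varSet_sw, hv, compl_compl]
  · intro v hv
    simp only [Finset.coe_filter, Finset.mem_univ, true_and, Set.mem_ofPred_eq] at hv ⊢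
    rw [hA.varSet_sw, hv]

theorem SignDesign.numVar_initialCols_sub [Fintype P] [Fintype V] (hsw : Function.Involutive sw)
    (hA : SignDesign sw A) {w : ℕ} (hw : w ≤ n) :
    numVar A (initialCols n (n - w)) = numVar A (initialCols n w) := by
  rw [← hA.numVar_compl hsw (initialCols n w)]
  refine hA.numVar_eq_of_card_eq ?_
  rw [Finset.card_compl, card_initialCols hw, card_initialCols (Nat.sub_le n w), Fintype.card_fin]

theorem SignDesign.card_vars [Fintype P] [Fintype V] (hA : SignDesign sw A) :
    Fintype.card V =
      ∑ w ∈ Finset.range (n + 1), n.choose w * numVar A (initialCols n w) := by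
  classical
  have hsum : Fintype.card V = ∑ S ∈ (Finset.univ : Finset (Fin n)).powerset, numVar A S := by
    rw [← Finset.card_univ, Finset.card_eq_sum_card_fiberwise (f := varSet A)
      (t := (Finset.univ : Finset (Fin n)).powerset) (fun _ _ => by simp)]
    refine Finset.sum_congr rfl fun S _ => ?_
    unfold numVar
    congr
  rw [hsum, Finset.sum_congr rfl fun S _ => hA.numVar_eq S,
    Finset.sum_powerset_apply_card (fun w => numVar A (initialCols n w))]
  simp

theorem SignDesign.card_rows [Fintype P] [Fintype V] (hA : SignDesign sw A) :
    Fintype.card P = numRow A Finset.univ +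
      ∑ w ∈ Finset.range n, n.choose w * numVar A (initialCols n (w + 1)) := by
  classical
  have hsum : Fintype.card P = ∑ S ∈ (Finset.univ : Finset (Fin n)).powerset, numRow A S := by
    rw [← Finset.card_univ, Finset.card_eq_sum_card_fiberwise (f := zeroSet A)
      (t := (Finset.univ : Finset (Fin n)).powerset) (fun _ _ => by simp)]
    refine Finset.sum_congr rfl fun S _ => ?_
    unfold numRow
    congr
  -- Zero rows have no column outside their zero set, so `numRow_eq` says nothing about them and
  -- they are counted apart.
  have h : ∀ T : Finset (Fin n), numRow A T =
      (fun w => if w = n then numRow A Finset.univ else numVar A (initialCols n (w + 1)))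
        T.card := by
    intro T
    by_cases hT : T.card = n
    · have : T = Finset.univ := by
        rw [← Finset.card_eq_iff_eq_univ, hT, Fintype.card_fin]
      simp [this]
    · have : ∃ c, c ∉ T := by
        by_contra hc
        push Not at hc
        exact hT (by rw [Finset.eq_univ_of_forall hc, Finset.card_univ, Fintype.card_fin])
      obtain ⟨c, hc⟩ := this
      simp only [if_neg hT]
      rw [hA.numRow_eq hc, hA.numVar_eq, Finset.card_insert_of_notMem hc]
  rw [hsum, Finset.sum_congr rfl fun T _ => h T,
    Finset.sum_powerset_apply_card
    (fun w => if w = n then numRow A Finset.univ else numVar A (initialCols n (w + 1)))]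
  simp only [Finset.card_univ, Fintype.card_fin, smul_eq_mul]
  rw [Finset.sum_range_succ, add_comm, if_pos rfl, Nat.choose_self, one_mul]
  congr 1
  refine Finset.sum_congr rfl fun w hw => ?_
  rw [if_neg (Finset.mem_range.mp hw).ne]

end Counting

/-! ### Hop operators and the parity of the middle weight -/

section Parity

open Matrix

variable {n : ℕ} {P V : Type*} {sw : V → V} {A : Fin n → Matrix P V ℤ}

theorem SignDesign.mul_self_of_ne_zero (hA : SignDesign sw A) {c r v} (h : A c r v ≠ 0) :
    A c r v * A c r v = 1 := by
  rcases hA.val c r v h with h | h <;> simp [h]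

variable [Fintype P]

/-- The operator that replaces the column `y` by the column `x` in an oriented variable, with the
product of the two signs that occur in the row containing both variables. -/
def hop (A : Fin n → Matrix P V ℤ) (x y : Fin n) : Matrix V V ℤ := (A x)ᵀ * A y

theorem hop_transpose (x y : Fin n) : (hop A x y)ᵀ = hop A y x := by
  simp [hop, Matrix.transpose_mul]

theorem SignDesign.of_hop_ne_zero (hA : SignDesign sw A) {x y a b} (h : hop A x y a b ≠ 0) :
    ∃ Z : Finset (Fin n), x ∉ Z ∧ y ∉ Z ∧ varSet A a = insert x Z ∧ varSet A b = insert y Z := by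
  rw [hop, Matrix.mul_apply] at h
  obtain ⟨r, -, hr⟩ := Finset.exists_ne_zero_of_sum_ne_zero h
  have hx : A x r a ≠ 0 := left_ne_zero_of_mul hr
  have hy : A y r b ≠ 0 := right_ne_zero_of_mul hr
  exact ⟨zeroSet A r, notMem_zeroSet.mpr ⟨a, hx⟩, notMem_zeroSet.mpr ⟨b, hy⟩,
    hA.varSet_eq_insert hx, hA.varSet_eq_insert hy⟩

theorem SignDesign.mem_iff_of_hop_ne_zero (hA : SignDesign sw A) {x y z : Fin n} {a b : V}
    (hzx : z ≠ x) (hzy : z ≠ y) (h : hop A x y a b ≠ 0) :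
    z ∈ varSet A a ↔ z ∈ varSet A b := by
  obtain ⟨Z, -, -, ha, hb⟩ := hA.of_hop_ne_zero h
  simp [ha, hb, hzx, hzy]

variable [DecidableEq V]

/-- The Alamouti relation in operator form: conjugation complements column sets, hence reverses a
hop, at the cost of a sign. -/
theorem SignDesign.hop_sw (hsw : Function.Involutive sw) (hA : SignDesign sw A) {x y : Fin n}
    (hxy : x ≠ y) : (hop A x y).submatrix sw sw = -hop A y x := by
  ext a b
  have h := hA.sum_mul hsw x y a (sw b)
  rw [if_neg fun h => hxy h.1, Finset.sum_add_distrib, hsw b] at h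
  simp only [hop, Matrix.submatrix_apply, Matrix.neg_apply, Matrix.mul_apply,
    Matrix.transpose_apply]
  rw [eq_neg_iff_add_eq_zero, ← h]
  congr 1
  exact Finset.sum_congr rfl fun r _ => mul_comm _ _

open Classical in
/-- The diagonal projector onto the oriented variables satisfying `p`. -/
noncomputable def proj (p : V → Prop) : Matrix V V ℤ := Matrix.diagonal fun v => if p v then 1 else 0

theorem SignDesign.hop_self (hA : SignDesign sw A) (c : Fin n) :
    hop A c c = proj fun v => c ∈ varSet A v := by
  classical
  ext a b
  rw [hop, Matrix.mul_apply, proj]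
  by_cases hab : a = b
  · subst hab
    rw [Matrix.diagonal_apply_eq]
    by_cases hc : c ∈ varSet A a
    · obtain ⟨r, hr⟩ := mem_varSet.mp hc
      rw [if_pos hc, Finset.sum_eq_single r]
      · exact hA.mul_self_of_ne_zero hr
      · intro s _ hs
        by_contra h0
        exact hs (hA.col_unique (right_ne_zero_of_mul h0) hr)
      · simp
    · rw [if_neg hc]
      refine Finset.sum_eq_zero fun r _ => ?_
      by_contra h0
      exact hc (mem_varSet.mpr ⟨r, right_ne_zero_of_mul h0⟩)
  · rw [Matrix.diagonal_apply_ne _ hab]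
    refine Finset.sum_eq_zero fun r _ => ?_
    by_contra h0
    exact hab (hA.unique (left_ne_zero_of_mul h0) (right_ne_zero_of_mul h0))

/-- The permutation matrix of the conjugation of oriented variables. -/
def swapMatrix (sw : V → V) : Matrix V V ℤ := (1 : Matrix V V ℤ).submatrix sw id

theorem swapMatrix_transpose (hsw : Function.Involutive sw) :
    (swapMatrix sw)ᵀ = swapMatrix sw := by
  ext a b
  simp only [swapMatrix, Matrix.transpose_apply, Matrix.submatrix_apply, Matrix.one_apply, id]
  congr 1
  rw [eq_iff_iff, ← hsw.injective.eq_iff, hsw b, eq_comm]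

variable [Fintype V]

theorem mul_proj {M : Matrix V V ℤ} {p : V → Prop} (h : ∀ a b, M a b ≠ 0 → p b) :
    M * proj p = M := by
  classical
  ext a b
  rw [proj, Matrix.mul_diagonal]
  by_cases hp : p b
  · simp [hp]
  · have : M a b = 0 := by
      by_contra h0
      exact hp (h a b h0)
    simp [this]

theorem proj_mul {M : Matrix V V ℤ} {p : V → Prop} (h : ∀ a b, M a b ≠ 0 → p a) :
    proj p * M = M := by
  classical
  ext a b
  rw [proj, Matrix.diagonal_mul]
  by_cases hp : p a
  · simp [hp]
  · have : M a b = 0 := by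
      by_contra h0
      exact hp (h a b h0)
    simp [this]

theorem commute_proj {M : Matrix V V ℤ} {p : V → Prop} (h : ∀ a b, M a b ≠ 0 → (p a ↔ p b)) :
    Commute (proj p) M := by
  classical
  ext a b
  rw [proj, Matrix.diagonal_mul, Matrix.mul_diagonal]
  by_cases h0 : M a b = 0
  · simp [h0]
  · simp [h a b h0]

theorem proj_mul_proj (p q : V → Prop) :
    (proj p * proj q : Matrix V V ℤ) = proj fun v => p v ∧ q v := by
  classical
  rw [proj, proj, proj, Matrix.diagonal_mul_diagonal]
  congr 1
  ext v
  by_cases hp : p v <;> by_cases hq : q v <;> simp [hp, hq]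

/-- `A d * (A d)ᵀ` projects onto the rows that are nonzero in column `d`. Passing it through `A c`
turns it into the projector onto variables missing `d`, so the detour through `d` costs no sign. -/
theorem SignDesign.hop_mul_hop (hA : SignDesign sw A) {c d : Fin n} (hcd : c ≠ d) (e : Fin n) :
    hop A e d * hop A d c = hop A e c * proj fun v => d ∉ varSet A v := by
  classical
  have key : A d * (A d)ᵀ * A c = A c * proj fun v => d ∉ varSet A v := by
    have hdiag : A d * (A d)ᵀ = Matrix.diagonal fun r => if d ∉ zeroSet A r then 1 else 0 := by
      ext r s
      rw [Matrix.mul_apply]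
      by_cases hrs : r = s
      · subst hrs
        rw [Matrix.diagonal_apply_eq]
        by_cases hd : d ∈ zeroSet A r
        · simp [hd, mem_zeroSet.mp hd]
        · obtain ⟨v, hv⟩ := notMem_zeroSet.mp hd
          rw [if_pos hd, Finset.sum_eq_single v]
          · exact hA.mul_self_of_ne_zero hv
          · intro u _ hu
            by_contra h0
            exact hu (hA.unique (left_ne_zero_of_mul h0) hv)
          · simp
      · rw [Matrix.diagonal_apply_ne _ hrs]
        refine Finset.sum_eq_zero fun v _ => ?_
        by_contra h0
        exact hrs (hA.col_unique (left_ne_zero_of_mul h0) (right_ne_zero_of_mul h0))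
    rw [hdiag]
    ext r v
    rw [Matrix.diagonal_mul, proj, Matrix.mul_diagonal]
    by_cases h0 : A c r v = 0
    · simp [h0]
    · simp only [hA.notMem_zeroSet_iff hcd h0]
      rw [mul_comm]
      congr
  rw [hop, hop, hop, Matrix.mul_assoc, ← Matrix.mul_assoc (A d), key, Matrix.mul_assoc]

/-- Conjugating `hop_mul_hop` by `sw` gives two signs on the left and one on the right. Here `c` is
occupied: it is vacated first and refilled from `e`. -/
theorem SignDesign.hop_mul_hop' (hsw : Function.Involutive sw) (hA : SignDesign sw A)
    {c d e : Fin n} (hcd : c ≠ d) (hce : c ≠ e) (hde : d ≠ e) :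
    hop A c e * hop A d c = -(hop A d e * proj fun v => c ∈ varSet A v) := by
  have h1 := hA.hop_sw hsw hce.symm
  have h2 := hA.hop_sw hsw hcd
  have h3 := hA.hop_sw hsw hde.symm
  have hp : (proj fun v => c ∉ varSet A v).submatrix sw sw = proj fun v => c ∈ varSet A v := by
    ext a b
    simp [proj, Matrix.diagonal_apply, hA.mem_varSet_sw, hsw.injective.eq_iff]
    congr
  have h := congrArg (fun M => M.submatrix sw sw) (hA.hop_mul_hop hcd.symm e)
  simp only [Matrix.submatrix_mul _ _ sw sw sw hsw.bijective] at h
  rw [h1, h2, h3, hp] at h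
  simpa using h

theorem SignDesign.hop_mul_proj_mem (hA : SignDesign sw A) (x y : Fin n) :
    (hop A x y * proj fun v => y ∈ varSet A v) = hop A x y :=
  mul_proj fun a b h => by
    obtain ⟨Z, -, -, -, hb⟩ := hA.of_hop_ne_zero h
    simp [hb]

theorem SignDesign.hop_mul_proj_notMem (hA : SignDesign sw A) {x y : Fin n} (hxy : x ≠ y) :
    (hop A x y * proj fun v => x ∉ varSet A v) = hop A x y :=
  mul_proj fun a b h => by
    obtain ⟨Z, hx, -, -, hb⟩ := hA.of_hop_ne_zero h
    simp [hb, hxy, hx]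

theorem SignDesign.proj_mem_mul_hop (hA : SignDesign sw A) (x y : Fin n) :
    (proj fun v => x ∈ varSet A v) * hop A x y = hop A x y :=
  proj_mul fun a b h => by
    obtain ⟨Z, -, -, ha, -⟩ := hA.of_hop_ne_zero h
    simp [ha]

theorem SignDesign.proj_notMem_mul_hop (hA : SignDesign sw A) {x y : Fin n} (hxy : x ≠ y) :
    (proj fun v => y ∉ varSet A v) * hop A x y = hop A x y :=
  proj_mul fun a b h => by
    obtain ⟨Z, -, hy, ha, -⟩ := hA.of_hop_ne_zero h
    simp [ha, hxy.symm, hy]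

/-- Route the second hop through the column `c` just vacated: splitting it there is free, and
recombining the other two hops costs one sign. -/
theorem SignDesign.hop_exchange_left (hsw : Function.Involutive sw) (hA : SignDesign sw A)
    {c d c' d' : Fin n} (h1 : c ≠ d) (h2 : c ≠ c') (h4 : d ≠ c') :
    hop A d' c' * hop A d c = -(hop A d' c * hop A d c') := by
  calc hop A d' c' * hop A d c
      = (hop A d' c' * proj fun v => c ∉ varSet A v) * hop A d c := by
        rw [Matrix.mul_assoc, hA.proj_notMem_mul_hop h1.symm]
    _ = hop A d' c * (hop A c c' * hop A d c) := by
        rw [← hA.hop_mul_hop h2.symm, Matrix.mul_assoc]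
    _ = -((hop A d' c * proj fun v => c ∈ varSet A v) * hop A d c') := by
        rw [hA.hop_mul_hop' hsw h1 h2 h4, Matrix.mul_neg, Matrix.mul_assoc,
          (commute_proj fun a b h => hA.mem_iff_of_hop_ne_zero h1 h2 h :
            Commute (proj fun v => c ∈ varSet A v) (hop A d c')).eq]
    _ = _ := by rw [hA.hop_mul_proj_mem]

theorem SignDesign.hop_exchange_right (hsw : Function.Involutive sw) (hA : SignDesign sw A)
    {c d c' d' : Fin n} (h3 : c ≠ d') (h4 : d ≠ c') (h5 : d ≠ d')
    (h6 : c' ≠ d') :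
    hop A d' c' * hop A d c = -(hop A d c' * hop A d' c) := by
  calc hop A d' c' * hop A d c
      = hop A d' c' * ((proj fun v => d' ∉ varSet A v) * hop A d c) := by
        rw [← Matrix.mul_assoc, hA.hop_mul_proj_notMem h6.symm]
    _ = hop A d' c' * (hop A d d' * hop A d' c) := by
        rw [hA.hop_mul_hop h3,
          (commute_proj fun a b h => not_congr (hA.mem_iff_of_hop_ne_zero h5.symm h3.symm h) :
            Commute (proj fun v => d' ∉ varSet A v) (hop A d c)).eq]
    _ = -(hop A d c' * ((proj fun v => d' ∈ varSet A v) * hop A d' c)) := by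
        rw [← Matrix.mul_assoc, hA.hop_mul_hop' hsw h5.symm h6.symm h4, Matrix.neg_mul,
          Matrix.mul_assoc]
    _ = _ := by rw [hA.proj_mem_mul_hop]

/-- Start from the crossed hops `c' ↦ d`, `c ↦ d'`. Exchanging sources or exchanging targets
uncrosses them, each with one sign, and the two results are the products in the two orders. -/
theorem SignDesign.commute_hop (hsw : Function.Involutive sw) (hA : SignDesign sw A)
    {c d c' d' : Fin n} (h1 : c ≠ d) (h2 : c ≠ c') (h3 : c ≠ d') (h4 : d ≠ c') (h5 : d ≠ d')
    (h6 : c' ≠ d') : Commute (hop A d' c') (hop A d c) := by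
  have e1 := hA.hop_exchange_left hsw (d' := d') h4.symm h2.symm h1.symm
  have e2 := hA.hop_exchange_right hsw h6 h1.symm h5 h3
  rw [e1, neg_inj] at e2
  exact e2

/-- The composition of the first `i` hops `c j ↦ d j`. -/
def hopProd (A : Fin n → Matrix P V ℤ) (c d : ℕ → Fin n) : ℕ → Matrix V V ℤ
  | 0 => 1
  | i + 1 => hop A (d i) (c i) * hopProd A c d i

theorem SignDesign.commute_hop_hopProd (hsw : Function.Involutive sw) (hA : SignDesign sw A)
    {m : ℕ} {c d : ℕ → Fin n} (hc : ∀ i < m, (c i : ℕ) = i) (hd : ∀ i < m, (d i : ℕ) = m + i)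
    {i j : ℕ} (hij : i ≤ j) (hj : j < m) : Commute (hop A (d j) (c j)) (hopProd A c d i) := by
  induction i with
  | zero => exact Commute.one_right _
  | succ i ih =>
    refine Commute.mul_right (hA.commute_hop hsw ?_ ?_ ?_ ?_ ?_ ?_) (ih (by omega)) <;>
      · intro h
        have := congrArg Fin.val h
        simp only [hc j hj, hd j hj, hc i (by omega), hd i (by omega)] at this
        omega

theorem commute_proj_hopProd {c d : ℕ → Fin n} {i : ℕ}
    {p : V → Prop} (h : ∀ j < i, ∀ a b, hop A (d j) (c j) a b ≠ 0 → (p a ↔ p b)) :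
    Commute (proj p) (hopProd A c d i) := by
  induction i with
  | zero => exact Commute.one_right _
  | succ i ih =>
    exact Commute.mul_right (commute_proj (h i (by omega))) (ih fun j hj => h j (by omega))

theorem SignDesign.hopProd_transpose_mul_self (hA : SignDesign sw A)
    {m : ℕ} {c d : ℕ → Fin n} (hc : ∀ i < m, (c i : ℕ) = i) (hd : ∀ i < m, (d i : ℕ) = m + i)
    {i : ℕ} (hi : i ≤ m) : (hopProd A c d i)ᵀ * hopProd A c d i =
      proj fun v => ∀ j < i, c j ∈ varSet A v ∧ d j ∉ varSet A v := by
  induction i with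
  | zero =>
    ext a b
    simp [hopProd, proj]
  | succ i ih =>
    have hne : ∀ x y : Fin n, (x : ℕ) ≠ y → x ≠ y := fun x y h h' => h (congrArg Fin.val h')
    have hcd : c i ≠ d i := hne _ _ (by rw [hc i (by omega), hd i (by omega)]; omega)
    have hcomm : Commute (proj fun v => c i ∈ varSet A v ∧ d i ∉ varSet A v)
        (hopProd A c d i) := by
      refine commute_proj_hopProd fun j hj a b h => ?_
      have h1 : c i ≠ c j := hne _ _ (by rw [hc i (by omega), hc j (by omega)]; omega)
      have h2 : c i ≠ d j := hne _ _ (by rw [hc i (by omega), hd j (by omega)]; omega)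
      have h3 : d i ≠ c j := hne _ _ (by rw [hd i (by omega), hc j (by omega)]; omega)
      have h4 : d i ≠ d j := hne _ _ (by rw [hd i (by omega), hd j (by omega)]; omega)
      rw [hA.mem_iff_of_hop_ne_zero h2 h1 h, hA.mem_iff_of_hop_ne_zero h4 h3 h]
    have hE : (hop A (d i) (c i))ᵀ * hop A (d i) (c i) =
        proj fun v => c i ∈ varSet A v ∧ d i ∉ varSet A v := by
      rw [hop_transpose, hA.hop_mul_hop hcd, hA.hop_self, proj_mul_proj]
    rw [hopProd, Matrix.transpose_mul, Matrix.mul_assoc, ← Matrix.mul_assoc (hop _ _ _)ᵀ, hE,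
      hcomm.eq, ← Matrix.mul_assoc, ih (by omega), proj_mul_proj]
    congr 1
    ext v
    rw [Nat.forall_lt_succ_right]

theorem swapMatrix_mul (M : Matrix V V ℤ) : swapMatrix sw * M = M.submatrix sw id := by
  ext a b
  simp [swapMatrix, Matrix.mul_apply, Matrix.one_apply]

theorem mul_swapMatrix (hsw : Function.Involutive sw) (M : Matrix V V ℤ) :
    M * swapMatrix sw = M.submatrix id sw := by
  rw [← Matrix.transpose_inj, Matrix.transpose_mul, swapMatrix_transpose hsw, swapMatrix_mul]
  rfl

theorem SignDesign.hop_mul_swapMatrix (hsw : Function.Involutive sw) (hA : SignDesign sw A)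
    {x y : Fin n} (hxy : x ≠ y) :
    hop A x y * swapMatrix sw = -(swapMatrix sw * hop A y x) := by
  rw [mul_swapMatrix hsw, swapMatrix_mul]
  have h := congrArg (fun M => M.submatrix sw id) (hA.hop_sw hsw hxy)
  simp only [Matrix.submatrix_submatrix, hsw.comp_self, Function.comp_id] at h
  exact h

/-- Each hop yields a sign when it passes the conjugation; the order reversed by transposition is
restored because disjoint hops commute. -/
theorem SignDesign.hopProd_transpose_mul_swapMatrix (hsw : Function.Involutive sw)
    (hA : SignDesign sw A) {m : ℕ} {c d : ℕ → Fin n} (hc : ∀ i < m, (c i : ℕ) = i)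
    (hd : ∀ i < m, (d i : ℕ) = m + i) {i : ℕ} (hi : i ≤ m) :
    (hopProd A c d i)ᵀ * swapMatrix sw = (-1 : ℤ) ^ i • (swapMatrix sw * hopProd A c d i) := by
  induction i with
  | zero => simp [hopProd]
  | succ i ih =>
    have hcd : c i ≠ d i := fun h => by
      have := congrArg Fin.val h
      rw [hc i (by omega), hd i (by omega)] at this
      omega
    rw [hopProd, Matrix.transpose_mul, Matrix.mul_assoc, hop_transpose,
      hA.hop_mul_swapMatrix hsw hcd, Matrix.mul_neg, ← Matrix.mul_assoc, ih (by omega),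
      Matrix.smul_mul, Matrix.mul_assoc,
      ← (hA.commute_hop_hopProd hsw hc hd le_rfl (by omega)).eq, pow_succ]
    simp

/-- A skew symmetric integer matrix whose Gram matrix is a coordinate projector acts on an even
number of coordinates. -/
theorem even_card_of_skew {B : Matrix V V ℤ} {p : V → Prop} (hskew : Bᵀ = -B)
    (hB : Bᵀ * B = proj p) : Even (Nat.card {v // p v}) := by
  classical
  -- A zero diagonal entry of the Gram matrix is a vanishing sum of squares, so that column of `B`
  -- is zero, and by skewness so is the row. The remaining block is orthogonal, while an odd skew
  -- block would have determinant `0`.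
  have hcol : ∀ a b, ¬ p b → B a b = 0 := by
    intro a b hb
    have h := congrFun (congrFun hB b) b
    rw [Matrix.mul_apply, proj, Matrix.diagonal_apply_eq, if_neg hb] at h
    simp only [Matrix.transpose_apply] at h
    rw [Finset.sum_eq_zero_iff_of_nonneg fun _ _ => mul_self_nonneg _] at h
    exact mul_self_eq_zero.mp (h a (Finset.mem_univ a))
  have hrow : ∀ a b, ¬ p a → B a b = 0 := by
    intro a b ha
    have h := congrFun (congrFun hskew b) a
    rw [Matrix.transpose_apply, Matrix.neg_apply, hcol b a ha, neg_zero] at h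
    exact h
  set B' : Matrix {v // p v} {v // p v} ℤ := B.submatrix Subtype.val Subtype.val with hB'
  have h1 : B'ᵀ * B' = 1 := by
    ext i j
    have h := congrFun (congrFun hB i) j
    rw [Matrix.mul_apply, ← Finset.sum_subset (Finset.subset_univ ({v | p v} : Finset V)),
      Finset.sum_subtype _ (p := p) (fun x => by simp)] at h
    · rw [Matrix.mul_apply]
      refine Eq.trans h ?_
      simp [proj, Matrix.diagonal_apply, Matrix.one_apply, i.2, Subtype.ext_iff]
    · intro x _ hx
      rw [hrow x j (by simpa using hx), mul_zero]
  have h2 : B'ᵀ = -B' := by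
    rw [hB', Matrix.transpose_submatrix, hskew]
    rfl
  have h3 := congrArg Matrix.det h1
  have h4 := congrArg Matrix.det h2
  rw [Matrix.det_mul, Matrix.det_transpose, Matrix.det_one] at h3
  rw [Matrix.det_transpose, Matrix.det_neg] at h4
  rw [Nat.card_eq_fintype_card]
  by_contra hodd
  rw [Nat.not_even_iff_odd] at hodd
  rw [hodd.neg_one_pow] at h4
  have : B'.det = 0 := by linarith
  rw [this] at h3
  norm_num at h3

/-- The hops carry the first `m` columns to the last `m`, and conjugation carries them back. The
resulting operator is skew as `m` is odd, and its Gram matrix projects onto the variables counted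
here, so `even_card_of_skew` applies. -/
theorem SignDesign.even_numVar (hsw : Function.Involutive sw) {m : ℕ} (hm : Odd m)
    {A : Fin (2 * m) → Matrix P V ℤ} (hA : SignDesign sw A) :
    Even (numVar A (initialCols (2 * m) m)) := by
  classical
  have hm0 : 0 < m := hm.pos
  -- The reduction modulo `2 * m` only makes `c` and `d` total; they are used at indices below `m`.
  let c : ℕ → Fin (2 * m) := fun i => ⟨i % (2 * m), Nat.mod_lt _ (by omega)⟩
  let d : ℕ → Fin (2 * m) := fun i => ⟨(m + i) % (2 * m), Nat.mod_lt _ (by omega)⟩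
  have hc : ∀ i < m, (c i : ℕ) = i := fun i hi => Nat.mod_eq_of_lt (by omega)
  have hd : ∀ i < m, (d i : ℕ) = m + i := fun i hi => Nat.mod_eq_of_lt (by omega)
  have hJ : swapMatrix sw * swapMatrix sw = 1 := by
    rw [swapMatrix_mul]
    ext a b
    change (1 : Matrix V V ℤ) (sw (sw a)) b = _
    rw [hsw a]
  have h1 : (swapMatrix sw * hopProd A c d m)ᵀ = -(swapMatrix sw * hopProd A c d m) := by
    rw [Matrix.transpose_mul, swapMatrix_transpose hsw,
      hA.hopProd_transpose_mul_swapMatrix hsw hc hd le_rfl, hm.neg_one_pow, neg_one_smul]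
  have h2 : (swapMatrix sw * hopProd A c d m)ᵀ * (swapMatrix sw * hopProd A c d m) =
      proj fun v => ∀ j < m, c j ∈ varSet A v ∧ d j ∉ varSet A v := by
    rw [Matrix.transpose_mul, swapMatrix_transpose hsw, Matrix.mul_assoc,
      ← Matrix.mul_assoc (swapMatrix sw), hJ, Matrix.one_mul,
      hA.hopProd_transpose_mul_self hc hd le_rfl]
  have h3 := even_card_of_skew h1 h2
  rw [Nat.card_eq_fintype_card, Fintype.card_subtype] at h3
  convert h3 using 1
  unfold numVar
  congr 1
  ext v
  rw [Finset.mem_filter_univ, Finset.mem_filter_univ]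
  constructor
  · intro h j hj
    simp [h, initialCols, hc j hj, hd j hj, hj]
  · intro h
    ext x
    rw [initialCols, Finset.mem_filter_univ]
    by_cases hx : (x : ℕ) < m
    · have : c x = x := Fin.ext (hc x hx)
      simp only [hx, iff_true]
      exact this ▸ (h x hx).1
    · have hx' : (x : ℕ) - m < m := by have := x.2; omega
      have : d (x - m) = x := Fin.ext (by rw [hd _ hx']; omega)
      simp only [hx, iff_false]
      have h' := (h _ hx').2
      rwa [this] at h'

end Parity

/-! ### Building designs from subsets and fermionic signs -/

section Construction

/-- A finite set with a fixed point free involution splits into two exchanged halves. -/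
theorem exists_equiv_swap {V : Type*} [Fintype V] {sw : V → V} (hsw : Function.Involutive sw)
    (hne : ∀ v, sw v ≠ v) {k : ℕ} (hk : Fintype.card V = 2 * k) :
    ∃ f : Fin k ⊕ Fin k ≃ V, ∀ v, f v.swap = sw (f v) := by
  classical
  let e := Fintype.equivFin V
  -- An arbitrary enumeration selects one element from each exchanged pair.
  let K := {v // e v < e (sw v)}
  let F : K ⊕ K → V := Sum.elim Subtype.val fun v => sw v.1
  have hlt : ∀ v, ¬ e v < e (sw v) → e (sw v) < e v := fun v h =>
    lt_of_le_of_ne (not_lt.mp h) fun h' => hne v (e.injective h')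
  have hF : Function.Bijective F := by
    constructor
    · rintro (⟨u, hu⟩ | ⟨u, hu⟩) (⟨v, hv⟩ | ⟨v, hv⟩) h
      · obtain rfl : u = v := h
        rfl
      · obtain rfl : u = sw v := h
        rw [hsw v] at hu
        exact absurd hv hu.asymm
      · obtain rfl : sw u = v := h
        rw [hsw u] at hv
        exact absurd hv hu.asymm
      · obtain rfl : u = v := hsw.injective h
        rfl
    · intro v
      by_cases h : e v < e (sw v)
      · exact ⟨Sum.inl ⟨v, h⟩, rfl⟩
      · exact ⟨Sum.inr ⟨sw v, by rw [hsw v]; exact hlt v h⟩, hsw v⟩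
  let E : K ⊕ K ≃ V := Equiv.ofBijective F hF
  have hK : Fintype.card K = k := by
    have := Fintype.card_congr E
    rw [Fintype.card_sum] at this
    omega
  let g : Fin k ≃ K := (Fintype.equivFinOfCardEq hK).symm
  refine ⟨(Equiv.sumCongr g g).trans E, ?_⟩
  rintro (j | j)
  · rfl
  · exact (hsw (g j).1).symm

variable {n : ℕ}

/-- The fermionic sign of inserting `c` into `T`. -/
def insertSign (c : Fin n) (T : Finset (Fin n)) : ℤ := (-1) ^ (T.filter (· < c)).card

/-- The elements below `c` in `T` and in the complement of `T ∪ {c, d}` are together all elements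
below `c` except `d`. -/
theorem insertSign_mul_compl {c d : Fin n} (hcd : c ≠ d) {T : Finset (Fin n)} (hc : c ∉ T)
    (hd : d ∉ T) :
    insertSign c T * insertSign c (insert c (insert d T))ᶜ =
      (-1) ^ (c : ℕ) * if d < c then -1 else 1 := by
  have hcard : (T.filter (· < c)).card + ((insert c (insert d T))ᶜ.filter (· < c)).card =
      ((Finset.univ.filter (· < c)).erase d).card := by
    rw [← Finset.card_union_of_disjoint]
    · congr 1
      ext x
      simp only [Finset.mem_union, Finset.mem_filter, Finset.mem_compl, Finset.mem_insert,
        Finset.mem_erase, Finset.mem_univ, true_and]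
      constructor
      · rintro (⟨h1, h2⟩ | ⟨h1, h2⟩)
        · exact ⟨fun h => hd (h ▸ h1), h2⟩
        · exact ⟨fun h => h1 (Or.inr (Or.inl h)), h2⟩
      · rintro ⟨h1, h2⟩
        by_cases hx : x ∈ T
        · exact Or.inl ⟨hx, h2⟩
        · refine Or.inr ⟨?_, h2⟩
          rintro (rfl | h | h)
          · exact lt_irrefl _ h2
          · exact h1 h
          · exact hx h
    · rw [Finset.disjoint_left]
      intro x hx hx'
      simp only [Finset.mem_filter, Finset.mem_compl, Finset.mem_insert] at hx hx'
      exact hx'.1 (Or.inr (Or.inr hx.1))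
  have hu : (Finset.univ.filter (· < c)).card = (c : ℕ) := by
    have h := card_initialCols c.2.le
    rwa [initialCols] at h
  rw [insertSign, insertSign, ← pow_add, hcard]
  by_cases h : d < c
  · have hmem : d ∈ Finset.univ.filter (· < c) := by simpa using h
    rw [if_pos h, ← hu, ← Finset.card_erase_add_one hmem, pow_succ]
    ring
  · rw [if_neg h, Finset.erase_eq_of_notMem (by simpa using h), hu, mul_one]

theorem insertSign_cases (c : Fin n) (T : Finset (Fin n)) :
    insertSign c T = 1 ∨ insertSign c T = -1 := neg_one_pow_eq_or ℤ _

/-- Exactly one of `d < c` and `c < d` holds, which gives the required minus sign. The remaining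
`(-1)^(c+d)` is what the signs `g` have to correct. -/
theorem insertSign_alamouti {c d : Fin n} (hcd : c ≠ d) {T : Finset (Fin n)} (hc : c ∉ T)
    (hd : d ∉ T) :
    (insertSign c T * insertSign c (insert c (insert d T))ᶜ) *
      (insertSign d T * insertSign d (insert c (insert d T))ᶜ) = -(-1) ^ (c + d : ℕ) := by
  rw [insertSign_mul_compl hcd hc hd, Finset.insert_comm c d,
    insertSign_mul_compl hcd.symm hd hc, pow_add]
  rcases lt_or_gt_of_ne hcd with h | h
  · rw [if_neg h.asymm, if_pos h]
    ring
  · rw [if_neg h.asymm, if_pos h]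
    ring

variable {I : Type*} {w : I → ℕ} {ι : I → I}

/-- Oriented variables: sets of columns with the size prescribed by their label. -/
abbrev LabelVar (n : ℕ) (w : I → ℕ) : Type _ :=
  {x : I × Finset (Fin n) // x.2.card = w x.1}

/-- Nonzero rows: sets of columns with one element less than prescribed by their label. -/
abbrev LabelRow (n : ℕ) (w : I → ℕ) : Type _ :=
  {x : I × Finset (Fin n) // x.2.card + 1 = w x.1}

/-- The oriented variable in column `c` of a row. -/
def LabelRow.var (r : LabelRow n w) (c : Fin n) (hc : c ∉ r.1.2) : LabelVar n w :=
  ⟨(r.1.1, insert c r.1.2), by rw [Finset.card_insert_of_notMem hc, r.2]⟩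

/-- Conjugation of oriented variables: complement of the set of columns. -/
def LabelVar.conj (hι : ∀ i, w (ι i) = n - w i) (v : LabelVar n w) : LabelVar n w :=
  ⟨(ι v.1.1, v.1.2ᶜ), by rw [Finset.card_compl, v.2, hι, Fintype.card_fin]⟩

variable (hι : ∀ i, w (ι i) = n - w i)

theorem LabelVar.conj_involutive (hι' : Function.Involutive ι) :
    Function.Involutive (LabelVar.conj hι : LabelVar n w → LabelVar n w) := by
  rintro ⟨⟨i, S⟩, h⟩
  simp [LabelVar.conj, hι' i]

open Classical in
/-- The signs of the design with the given labels, sign function `g` and rows of zeros `Z`. -/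
noncomputable def labelDesign (Z : Type*) (g : LabelVar n w → ℤ) (c : Fin n) :
    Matrix (LabelRow n w ⊕ Z) (LabelVar n w) ℤ := fun r v =>
  match r with
  | Sum.inl r => if ∃ hc : c ∉ r.1.2, v = r.var c hc then insertSign c r.1.2 * g v else 0
  | Sum.inr _ => 0

variable {Z : Type*} {g : LabelVar n w → ℤ}

theorem labelDesign_var (r : LabelRow n w) {c : Fin n} (hc : c ∉ r.1.2) :
    labelDesign Z g c (Sum.inl r) (r.var c hc) = insertSign c r.1.2 * g (r.var c hc) := by
  simp [labelDesign, hc]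

theorem labelDesign_var_ne_zero (hg : ∀ v, g v = 1 ∨ g v = -1) (r : LabelRow n w) {c : Fin n}
    (hc : c ∉ r.1.2) : labelDesign Z g c (Sum.inl r) (r.var c hc) ≠ 0 := by
  rw [labelDesign_var]
  rcases insertSign_cases c r.1.2 with h | h <;> rcases hg (r.var c hc) with h' | h' <;>
    simp [h, h']

theorem exists_of_labelDesign_ne_zero {c : Fin n} {r : LabelRow n w ⊕ Z} {v : LabelVar n w}
    (h : labelDesign Z g c r v ≠ 0) :
    ∃ (s : LabelRow n w) (hc : c ∉ s.1.2), r = Sum.inl s ∧ v = s.var c hc := by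
  rcases r with r | r
  · by_cases h' : ∃ hc : c ∉ r.1.2, v = r.var c hc
    · exact ⟨r, h'.1, rfl, h'.2⟩
    · simp [labelDesign, h'] at h
  · simp [labelDesign] at h

/-- The row in which the oriented variable `v` occurs in column `c`. -/
def LabelVar.row (v : LabelVar n w) (c : Fin n) (hc : c ∈ v.1.2) : LabelRow n w :=
  ⟨(v.1.1, v.1.2.erase c), by rw [Finset.card_erase_add_one hc, v.2]⟩

theorem LabelVar.notMem_row (v : LabelVar n w) (c : Fin n) (hc : c ∈ v.1.2) :
    c ∉ (v.row c hc).1.2 := Finset.notMem_erase c _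

theorem LabelVar.var_row (v : LabelVar n w) (c : Fin n) (hc : c ∈ v.1.2) :
    (v.row c hc).var c (v.notMem_row c hc) = v := by
  rcases v with ⟨⟨i, S⟩, h⟩
  simp only [LabelRow.var, LabelVar.row, Subtype.mk.injEq, Prod.mk.injEq, true_and]
  exact Finset.insert_erase hc

theorem LabelRow.var_inj {r s : LabelRow n w} {c : Fin n} {hr : c ∉ r.1.2} {hs : c ∉ s.1.2}
    (h : r.var c hr = s.var c hs) : r = s := by
  rcases r with ⟨⟨i, T⟩, h1⟩
  rcases s with ⟨⟨j, T'⟩, h2⟩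
  simp only [LabelRow.var, Subtype.mk.injEq, Prod.mk.injEq] at h hr hs ⊢
  refine ⟨h.1, ?_⟩
  rw [← Finset.erase_insert hr, h.2, Finset.erase_insert hs]

theorem labelDesign_signDesign (hg : ∀ v, g v = 1 ∨ g v = -1)
    (hgg : ∀ (r : LabelRow n w) (c d : Fin n) (hc : c ∉ r.1.2) (hd : d ∉ r.1.2), c ≠ d →
      (g (r.var c hc) * g (LabelVar.conj hι (r.var c hc))) *
        (g (r.var d hd) * g (LabelVar.conj hι (r.var d hd))) = (-1) ^ (c + d : ℕ)) :
    SignDesign (LabelVar.conj hι) (labelDesign Z g) where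
  val c r v h := by
    obtain ⟨s, hc, rfl, rfl⟩ := exists_of_labelDesign_ne_zero h
    rw [labelDesign_var]
    rcases insertSign_cases c s.1.2 with h | h <;> rcases hg (s.var c hc) with h' | h' <;>
      simp [h, h']
  unique := by
    intro c r u v hu hv
    obtain ⟨s, hc, rfl, rfl⟩ := exists_of_labelDesign_ne_zero hu
    obtain ⟨s', hc', h, rfl⟩ := exists_of_labelDesign_ne_zero hv
    obtain rfl := Sum.inl_injective h
    rfl
  col_unique := by
    intro c r s v hr hs
    obtain ⟨r', hc, rfl, rfl⟩ := exists_of_labelDesign_ne_zero hr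
    obtain ⟨s', hc', rfl, h⟩ := exists_of_labelDesign_ne_zero hs
    rw [LabelRow.var_inj h]
  col_exists c v := by
    have key : ∀ v : LabelVar n w, c ∈ v.1.2 → ∃ r, labelDesign Z g c r v ≠ 0 := fun v hc =>
      ⟨Sum.inl (v.row c hc), by
        have h := labelDesign_var_ne_zero (Z := Z) hg _ (v.notMem_row c hc)
        rwa [v.var_row c hc] at h⟩
    by_cases hc : c ∈ v.1.2
    · exact Or.inl (key v hc)
    · exact Or.inr (key _ (Finset.mem_compl.mpr hc))
  col_not_both := by
    intro c r s v hr hs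
    obtain ⟨r', hc, rfl, rfl⟩ := exists_of_labelDesign_ne_zero hr
    obtain ⟨s', hc', rfl, h⟩ := exists_of_labelDesign_ne_zero hs
    have h1 : c ∈ (s'.var c hc').1.2 := Finset.mem_insert_self c _
    rw [← h] at h1
    exact Finset.mem_compl.mp h1 (Finset.mem_insert_self c _)
  alamouti := by
    intro c d r u v hcd hv hu
    obtain ⟨r, hc, rfl, rfl⟩ := exists_of_labelDesign_ne_zero hv
    obtain ⟨r', hd, h, rfl⟩ := exists_of_labelDesign_ne_zero hu
    obtain rfl := Sum.inl_injective h
    -- The Alamouti partner of row `T` for the columns `c`, `d` is the row given by the complement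
    -- of `T ∪ {c, d}`.
    have hcs : c ∈ (LabelVar.conj hι (r.var d hd)).1.2 := by
      simp [LabelVar.conj, LabelRow.var, hc, hcd]
    have hrow : ((LabelVar.conj hι (r.var d hd)).row c hcs).1.2 =
        (insert c (insert d r.1.2))ᶜ := by
      simp [LabelVar.row, LabelVar.conj, LabelRow.var]
    have hds : d ∉ ((LabelVar.conj hι (r.var d hd)).row c hcs).1.2 := by
      rw [hrow]
      simp
    have hvar : ((LabelVar.conj hι (r.var d hd)).row c hcs).var d hds =
        LabelVar.conj hι (r.var c hc) := by
      refine Subtype.ext (Prod.ext rfl ?_)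
      change insert d (((insert d r.1.2)ᶜ).erase c) = (insert c r.1.2)ᶜ
      ext x
      simp only [Finset.mem_insert, Finset.mem_erase, Finset.mem_compl]
      by_cases hx : x = d
      · subst hx
        simp [hd, hcd.symm]
      · simp [hx]
    have hc' := (LabelVar.conj hι (r.var d hd)).notMem_row c hcs
    have e1 := labelDesign_var (Z := Z) (g := g) _ hc'
    have n1 := labelDesign_var_ne_zero (Z := Z) hg _ hc'
    have e2 := labelDesign_var (Z := Z) (g := g) _ hds
    have n2 := labelDesign_var_ne_zero (Z := Z) hg _ hds
    rw [LabelVar.var_row, hrow] at e1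
    rw [LabelVar.var_row] at n1
    rw [hvar, hrow] at e2
    rw [hvar] at n2
    refine ⟨_, n1, n2, ?_⟩
    rw [e1, e2, labelDesign_var, labelDesign_var]
    have h1 := insertSign_alamouti hcd hc hd
    have h2 := hgg r c d hc hd hcd
    have sq : ∀ x : ℤ, x = 1 ∨ x = -1 → x * x = 1 := by
      rintro x (rfl | rfl) <;> rfl
    have s1 := sq _ (insertSign_cases c (insert c (insert d r.1.2))ᶜ)
    have s2 := sq _ (insertSign_cases d (insert c (insert d r.1.2))ᶜ)
    have s3 := sq _ (hg (LabelVar.conj hι (r.var c hc)))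
    have s4 := sq _ (hg (LabelVar.conj hι (r.var d hd)))
    have s5 := sq _ (neg_one_pow_eq_or ℤ (c + d : ℕ))
    generalize insertSign c (insert c (insert d r.1.2))ᶜ = x at *
    generalize insertSign d (insert c (insert d r.1.2))ᶜ = y at *
    generalize g (LabelVar.conj hι (r.var c hc)) = a at *
    generalize g (LabelVar.conj hι (r.var d hd)) = b at *
    -- With `Y * Y = 1`, the identity `X * Y = -1` forces `X = -Y`.
    have hY : (x * b * (y * a)) * (x * b * (y * a)) = 1 := by
      rw [show (x * b * (y * a)) * (x * b * (y * a)) =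
        (x * x) * (y * y) * (a * a) * (b * b) by ring, s1, s2, s3, s4]
      norm_num
    have hXY : (insertSign c r.1.2 * g (r.var c hc) * (insertSign d r.1.2 * g (r.var d hd))) *
        (x * b * (y * a)) = -1 := by
      rw [← s5]
      linear_combination (-1 : ℤ) ^ (c + d : ℕ) * h1 +
        (insertSign c r.1.2 * x * (insertSign d r.1.2 * y)) * h2
    linear_combination (x * b * (y * a)) * hXY -
      (insertSign c r.1.2 * g (r.var c hc) * (insertSign d r.1.2 * g (r.var d hd))) * hY
  first := by
    intro c d r s v hcd hr hs
    obtain ⟨r, hc, rfl, rfl⟩ := exists_of_labelDesign_ne_zero hr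
    obtain ⟨s, hd, rfl, h⟩ := exists_of_labelDesign_ne_zero hs
    have h1 : d ∈ (s.var d hd).1.2 := Finset.mem_insert_self d _
    rw [← h] at h1
    have h2 : d ∉ r.1.2 := fun h' =>
      Finset.mem_compl.mp h1 (Finset.mem_insert_of_mem h')
    exact ⟨_, labelDesign_var_ne_zero hg r h2⟩

theorem card_labelVar [Fintype I] : Fintype.card (LabelVar n w) = ∑ i, n.choose (w i) := by
  classical
  rw [Fintype.card_congr (Equiv.subtypeProdEquivSigmaSubtype
    (fun (i : I) (S : Finset (Fin n)) => S.card = w i)), Fintype.card_sigma]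
  refine Finset.sum_congr rfl fun i _ => ?_
  rw [Fintype.card_finset_len, Fintype.card_fin]

/-- The number of subsets of an `n`-set with one element less than `w`. -/
def choosePred (n : ℕ) : ℕ → ℕ
  | 0 => 0
  | w + 1 => n.choose w

theorem card_labelRow [Fintype I] : Fintype.card (LabelRow n w) = ∑ i, choosePred n (w i) := by
  classical
  rw [Fintype.card_congr (Equiv.subtypeProdEquivSigmaSubtype
    (fun (i : I) (S : Finset (Fin n)) => S.card + 1 = w i)), Fintype.card_sigma]
  refine Finset.sum_congr rfl fun i _ => ?_
  rcases hw : w i with _ | w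
  · simp [choosePred]
  · simp only [add_left_inj, choosePred]
    rw [Fintype.card_finset_len, Fintype.card_fin]

theorem exists_isFirstTypeCOD_of_labels [Fintype I] (hn : 0 < n) (hι' : Function.Involutive ι)
    (hg : ∀ v, g v = 1 ∨ g v = -1)
    (hgg : ∀ (r : LabelRow n w) (c d : Fin n) (hc : c ∉ r.1.2) (hd : d ∉ r.1.2), c ≠ d →
      (g (r.var c hc) * g (LabelVar.conj hι (r.var c hc))) *
        (g (r.var d hd) * g (LabelVar.conj hι (r.var d hd))) = (-1) ^ (c + d : ℕ))
    {p k z : ℕ} (hp : p = z + ∑ i, choosePred n (w i)) (hk : 2 * k = ∑ i, n.choose (w i)) :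
    ∃ O : Matrix (Fin p) (Fin n) (CODRing k), IsFirstTypeCOD O := by
  obtain ⟨f, hf⟩ := exists_equiv_swap (V := LabelVar n w) (LabelVar.conj_involutive hι hι')
    -- No set equals its complement, since column `0` lies in exactly one of them.
    (fun v h => by
      have h' := congrArg (fun v => (⟨0, hn⟩ : Fin n) ∈ v.1.2) h
      simp [LabelVar.conj] at h') (card_labelVar.trans hk.symm)
  refine exists_isFirstTypeCOD_of_signDesign (labelDesign_signDesign (Z := Fin z) hι hg hgg)
    (Fintype.equivFinOfCardEq ?_).symm f hf
  rw [Fintype.card_sum, card_labelRow, Fintype.card_fin, hp, add_comm]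

/-- The parity of the sum of the columns in a set. -/
def sumSign (S : Finset (Fin n)) : ℤ := (-1) ^ (∑ x ∈ S, (x : ℕ))

theorem sumSign_cases (S : Finset (Fin n)) : sumSign S = 1 ∨ sumSign S = -1 :=
  neg_one_pow_eq_or ℤ _

theorem sumSign_mul_self (S : Finset (Fin n)) : sumSign S * sumSign S = 1 := by
  rcases sumSign_cases S with h | h <;> simp [h]

theorem sumSign_insert {S : Finset (Fin n)} {c : Fin n} (hc : c ∉ S) :
    sumSign (insert c S) = (-1) ^ (c : ℕ) * sumSign S := by
  rw [sumSign, Finset.sum_insert hc, pow_add, sumSign]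

theorem sumSign_mul_compl (S : Finset (Fin n)) :
    sumSign S * sumSign Sᶜ = (-1) ^ (n * (n - 1) / 2) := by
  rw [sumSign, sumSign, ← pow_add, Finset.sum_add_sum_compl, Fin.sum_univ_eq_sum_range (fun x => x),
    Finset.sum_range_id]

/-- Labels of `t j` full components of each weight `j < M`, with two orientations, and of `h` half
components. -/
abbrev ComponentLabel (M : ℕ) (t : ℕ → ℕ) (h : ℕ) : Type :=
  ((Σ j : Fin M, Fin (t j)) × Bool) ⊕ Fin h

/-- The size of the sets of columns in a component. -/
def ComponentLabel.weight (n : ℕ) {M : ℕ} {t : ℕ → ℕ} {h : ℕ} : ComponentLabel M t h → ℕ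
  | Sum.inl (j, true) => j.1
  | Sum.inl (j, false) => n - j.1
  | Sum.inr _ => n / 2

/-- Reversal of the orientation of the full components. -/
def ComponentLabel.reverse {M : ℕ} {t : ℕ → ℕ} {h : ℕ} : ComponentLabel M t h → ComponentLabel M t h
  | Sum.inl (j, b) => Sum.inl (j, !b)
  | Sum.inr x => Sum.inr x

theorem ComponentLabel.reverse_involutive {M : ℕ} {t : ℕ → ℕ} {h : ℕ} :
    Function.Involutive (ComponentLabel.reverse : ComponentLabel M t h → _) := by
  rintro (⟨j, b⟩ | x) <;> simp [ComponentLabel.reverse]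

/-- The correction of the fermionic signs in each component. -/
def componentSign (hn : 0 < n) {M : ℕ} {t : ℕ → ℕ} {h : ℕ}
    (v : LabelVar n (ComponentLabel.weight n : ComponentLabel M t h → ℕ)) : ℤ :=
  match v.1.1 with
  | Sum.inl (_, true) => sumSign v.1.2
  | Sum.inl (_, false) => 1
  | Sum.inr _ => if ⟨0, hn⟩ ∈ v.1.2 then sumSign v.1.2 else 1

theorem choosePred_sub {j : ℕ} (hj : j ≤ n) : choosePred n (n - j) = n.choose (j + 1) := by
  rcases hj.lt_or_eq with h | rfl
  · obtain ⟨m, hm⟩ : ∃ m, n - j = m + 1 := ⟨n - j - 1, by omega⟩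
    rw [hm, choosePred, ← Nat.choose_symm (by omega : j + 1 ≤ n)]
    congr 1
    omega
  · simp [choosePred]

/-- Weights `j` and `n - j` form one full component with conjugation exchanging them; a half
component is a single copy of weight `n / 2`, closed under complement. The sign condition holds once
`g v * g (conj v)` is, up to a constant of the component, the parity of the column sum of `v`. -/
theorem exists_isFirstTypeCOD_of_components (hn : 0 < n) {M h p k z : ℕ} {t : ℕ → ℕ}
    (hM : ∀ j < M, j ≤ n) (hh : h = 0 ∨ n % 4 = 0)
    (hp : p = z + ∑ j ∈ Finset.range M, t j * (choosePred n j + n.choose (j + 1)) +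
      h * n.choose (n / 2 - 1))
    (hk : k = ∑ j ∈ Finset.range M, t j * n.choose j + h * (n - 1).choose (n / 2 - 1)) :
    ∃ O : Matrix (Fin p) (Fin n) (CODRing k), IsFirstTypeCOD O := by
  have hn4 : 0 < h → ∃ m, n = 4 * (m + 1) := fun h0 => ⟨n / 4 - 1, by omega⟩
  have hι : ∀ i : ComponentLabel M t h, ComponentLabel.weight n i.reverse =
      n - ComponentLabel.weight n i := by
    rintro (⟨j, _ | _⟩ | x)
    · have := hM j.1 j.1.2
      simp only [ComponentLabel.reverse, ComponentLabel.weight, Bool.not_false]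
      omega
    · simp [ComponentLabel.reverse, ComponentLabel.weight]
    · obtain ⟨m, hm⟩ := hn4 x.pos
      simp only [ComponentLabel.reverse, ComponentLabel.weight]
      omega
  refine exists_isFirstTypeCOD_of_labels (I := ComponentLabel M t h) (z := z)
    (g := componentSign hn) hι hn ComponentLabel.reverse_involutive ?_ ?_ ?_ ?_
  · rintro ⟨⟨⟨j, _ | _⟩ | x, S⟩, hS⟩
    · exact Or.inl rfl
    · exact sumSign_cases S
    · simp only [componentSign]
      split_ifs
      · exact sumSign_cases S
      · exact Or.inl rfl
  · rintro ⟨⟨i, T⟩, hT⟩ c d hc hd hcd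
    simp only at hc hd
    have hins : sumSign (insert c T) * sumSign (insert d T) = (-1) ^ (c + d : ℕ) := by
      rw [sumSign_insert hc, sumSign_insert hd, pow_add]
      linear_combination (-1 : ℤ) ^ (c : ℕ) * (-1) ^ (d : ℕ) * sumSign_mul_self T
    rcases i with ⟨j, _ | _⟩ | x
    -- Here the sign comes from the complements; it differs from that of the sets by a constant,
    -- which cancels between `c` and `d`.
    · have h1 := sumSign_mul_compl (insert c T)
      have h2 := sumSign_mul_compl (insert d T)
      have h3 := sumSign_mul_self (insert c T)
      have h4 := sumSign_mul_self (insert d T)ᶜ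
      rw [← h1] at h2
      simp only [LabelRow.var, LabelVar.conj, componentSign, ComponentLabel.reverse, Bool.not_false,
        one_mul]
      rw [← hins]
      linear_combination -(sumSign (insert c T)ᶜ * sumSign (insert d T)ᶜ) * h3 -
        sumSign (insert c T) * sumSign (insert d T)ᶜ * h2 +
        sumSign (insert c T) * sumSign (insert d T) * h4
    · simpa [LabelRow.var, LabelVar.conj, componentSign, ComponentLabel.reverse] using hins
    · obtain ⟨m, hm⟩ := hn4 x.pos
      -- Exactly one of `S` and `Sᶜ` contains column `0` and supplies the sign. Both have the same
      -- column parity because `n(n-1)/2` is even when `4 ∣ n`.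
      have hhalf : ∀ S : Finset (Fin n), (if ⟨0, hn⟩ ∈ S then sumSign S else 1) *
          (if ⟨0, hn⟩ ∈ Sᶜ then sumSign Sᶜ else 1) = sumSign S := by
        intro S
        have hS := sumSign_mul_compl S
        have hev : (-1 : ℤ) ^ (n * (n - 1) / 2) = 1 := by
          refine Even.neg_one_pow ?_
          have : n * (n - 1) = 2 * (2 * ((m + 1) * (n - 1))) := by
            calc n * (n - 1) = 4 * (m + 1) * (n - 1) := by rw [← hm]
              _ = _ := by ring
          rw [this, Nat.mul_div_cancel_left _ two_pos]
          exact even_two_mul _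
        rw [hev] at hS
        by_cases h0 : (⟨0, hn⟩ : Fin n) ∈ S
        · simp [h0]
        · simp only [h0, if_false, Finset.mem_compl, not_false_eq_true, if_true, one_mul]
          linear_combination sumSign S * hS - sumSign Sᶜ * sumSign_mul_self S
      exact (congrArg₂ (· * ·) (hhalf (insert c T)) (hhalf (insert d T))).trans hins
  · have hhalf : choosePred n (n / 2) * h = h * n.choose (n / 2 - 1) := by
      rcases hh with rfl | hh
      · simp
      · obtain ⟨m, hm⟩ : ∃ m, n / 2 = m + 1 := ⟨n / 2 - 1, by omega⟩
        rw [hm, choosePred, Nat.add_sub_cancel, mul_comm]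
    rw [hp, add_assoc, add_right_inj, Fintype.sum_sum_type, Fintype.sum_prod_type]
    simp only [Fintype.sum_bool, Fintype.sum_sigma, ComponentLabel.weight, Finset.sum_const,
      Finset.card_univ, Fintype.card_fin, smul_eq_mul]
    rw [mul_comm h (choosePred _ _), hhalf, add_left_inj,
      ← Fin.sum_univ_eq_sum_range (fun j => t j * (choosePred n j + n.choose (j + 1)))]
    refine Finset.sum_congr rfl fun j _ => ?_
    rw [choosePred_sub (hM j j.2)]
  · have hhalf : h * n.choose (n / 2) = 2 * (h * (n - 1).choose (n / 2 - 1)) := by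
      rcases hh with rfl | hh
      · simp
      · obtain ⟨m, hm⟩ : ∃ m, n = 2 * (m + 1) := ⟨n / 2 - 1, by omega⟩
        have e1 : n / 2 = m + 1 := by omega
        have e2 : n - 1 = 2 * m + 1 := by omega
        rw [e1, e2, hm, Nat.add_sub_cancel, show 2 * (m + 1) = 2 * m + 1 + 1 by ring,
          Nat.choose_succ_succ, Nat.choose_symm_half]
        ring
    rw [hk, Fintype.sum_sum_type, Fintype.sum_prod_type]
    simp only [Fintype.sum_bool, Fintype.sum_sigma, ComponentLabel.weight, Finset.sum_const,
      Finset.card_univ, Fintype.card_fin, smul_eq_mul]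
    rw [mul_add, ← hhalf, add_left_inj, Finset.mul_sum,
      ← Fin.sum_univ_eq_sum_range (fun j => 2 * (t j * n.choose j))]
    refine Finset.sum_congr rfl fun j _ => ?_
    rw [Nat.choose_symm (hM j j.2)]
    ring

end Construction

/-! ### Folding the counts into the stated sums -/

section Parameters

theorem sum_range_symm_odd {m : ℕ} {f : ℕ → ℕ} (hf : ∀ w ≤ 2 * m + 1, f (2 * m + 1 - w) = f w) :
    ∑ w ∈ Finset.range (2 * m + 1 + 1), f w = 2 * ∑ w ∈ Finset.range (m + 1), f w := by
  rw [show 2 * m + 1 + 1 = (m + 1) + (m + 1) by ring, Finset.sum_range_add, two_mul,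
    add_right_inj, ← Finset.sum_range_reflect f]
  refine Finset.sum_congr rfl fun w hw => ?_
  rw [Finset.mem_range] at hw
  rw [← hf (m + 1 + w) (by omega)]
  congr 1
  omega

theorem sum_range_symm_even {m : ℕ} {f : ℕ → ℕ} (hf : ∀ w ≤ 2 * m, f (2 * m - w) = f w) :
    ∑ w ∈ Finset.range (2 * m + 1), f w = 2 * ∑ w ∈ Finset.range m, f w + f m := by
  rw [show 2 * m + 1 = (m + 1) + m by ring, Finset.sum_range_add, Finset.sum_range_succ,
    ← Finset.sum_range_reflect f m]
  have : ∑ w ∈ Finset.range m, f (m + 1 + w) = ∑ w ∈ Finset.range m, f (m - 1 - w) := by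
    refine Finset.sum_congr rfl fun w hw => ?_
    rw [Finset.mem_range] at hw
    rw [← hf (m + 1 + w) (by omega)]
    congr 1
    omega
  rw [this]
  ring

theorem choosePred_add_choose_symm {n w : ℕ} (hw : w ≤ n) :
    choosePred n (n - w) + n.choose (n - w + 1) = choosePred n w + n.choose (w + 1) := by
  have h := choosePred_sub (Nat.sub_le n w)
  rw [Nat.sub_sub_self hw] at h
  rw [choosePred_sub hw, h, add_comm]

/-- By the symmetry of `N`, the terms with `choosePred` and those with `n.choose (w + 1)` each add
up to the number of nonzero rows. -/
theorem sum_choosePred_add_choose {n : ℕ} {N : ℕ → ℕ} (hN : ∀ w ≤ n, N (n - w) = N w) :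
    ∑ w ∈ Finset.range (n + 1), N w * (choosePred n w + n.choose (w + 1)) =
      2 * ∑ w ∈ Finset.range n, n.choose w * N (w + 1) := by
  simp only [mul_add, Finset.sum_add_distrib]
  rw [Finset.sum_range_succ', Finset.sum_range_succ (fun w => N w * n.choose (w + 1)),
    ← Finset.sum_range_reflect (fun w => N w * n.choose (w + 1)), two_mul]
  simp only [choosePred, mul_zero, add_zero, Nat.choose_succ_self]
  congr 1
  · exact Finset.sum_congr rfl fun w _ => mul_comm _ _
  · refine Finset.sum_congr rfl fun w hw => ?_
    rw [Finset.mem_range] at hw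
    rw [mul_comm, ← hN (w + 1) hw, ← Nat.choose_symm hw.le, show n - 1 - w + 1 = n - w by omega,
      show n - 1 - w = n - (w + 1) by omega]

variable {p n k : ℕ} {O : Matrix (Fin p) (Fin n) (CODRing k)}

theorem IsFirstTypeCOD.exists_counts (hO : IsFirstTypeCOD O) :
    ∃ (z : ℕ) (N : ℕ → ℕ), (∀ w ≤ n, N (n - w) = N w) ∧ (n % 4 = 2 → Even (N (n / 2))) ∧
      2 * k = ∑ w ∈ Finset.range (n + 1), N w * n.choose w ∧
      2 * p = 2 * z +
        ∑ w ∈ Finset.range (n + 1), N w * (choosePred n w + n.choose (w + 1)) := by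
  have hA := hO.signDesign
  have hsw : Function.Involutive (Sum.swap : Fin k ⊕ Fin k → Fin k ⊕ Fin k) := Sum.swap_swap
  have hN : ∀ w ≤ n, numVar (entrySign O) (initialCols n (n - w)) =
      numVar (entrySign O) (initialCols n w) := fun w hw => hA.numVar_initialCols_sub hsw hw
  refine ⟨numRow (entrySign O) Finset.univ, fun w => numVar (entrySign O) (initialCols n w), hN,
    ?_, ?_, ?_⟩
  · intro h
    obtain ⟨m, rfl⟩ : ∃ m, n = 2 * m := ⟨n / 2, by omega⟩
    rw [Nat.mul_div_cancel_left m two_pos]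
    exact hA.even_numVar hsw (Nat.odd_iff.mpr (by omega))
  · have h := hA.card_vars
    rw [Fintype.card_sum, Fintype.card_fin] at h
    rw [two_mul, h]
    exact Finset.sum_congr rfl fun w _ => mul_comm _ _
  · have h := hA.card_rows
    rw [Fintype.card_fin] at h
    rw [sum_choosePred_add_choose (N := fun w => numVar (entrySign O) (initialCols n w)) hN]
    omega

theorem two_mul_choosePred_half {m : ℕ} (hm : 0 < m) :
    choosePred (2 * m) m + (2 * m).choose (m + 1) = 2 * (2 * m).choose (m - 1) := by
  have h := choosePred_add_choose_symm (n := 2 * m) (w := m) (by omega)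
  obtain ⟨l, rfl⟩ : ∃ l, m = l + 1 := ⟨m - 1, by omega⟩
  rw [choosePred, two_mul ((2 * (l + 1)).choose _), Nat.add_sub_cancel, add_right_inj,
    ← Nat.choose_symm (by omega : l + 1 + 1 ≤ 2 * (l + 1))]
  congr 1
  omega

theorem choose_half {m : ℕ} (hm : 0 < m) :
    (2 * m).choose m = 2 * (2 * m - 1).choose (m - 1) := by
  obtain ⟨l, rfl⟩ : ∃ l, m = l + 1 := ⟨m - 1, by omega⟩
  rw [Nat.add_sub_cancel, show 2 * (l + 1) - 1 = 2 * l + 1 by omega,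
    show 2 * (l + 1) = 2 * l + 1 + 1 by ring, Nat.choose_succ_succ, Nat.choose_symm_half]
  ring

theorem IsFirstTypeCOD.exists_components_odd (hO : IsFirstTypeCOD O) (hn : n % 2 = 1) :
    ∃ (z : ℕ) (t : ℕ → ℕ),
      p = z + ∑ j ∈ Finset.range (n / 2 + 1), t j * (choosePred n j + n.choose (j + 1)) ∧
      k = ∑ j ∈ Finset.range (n / 2 + 1), t j * n.choose j := by
  obtain ⟨z, N, hN, -, hk, hp⟩ := hO.exists_counts
  obtain ⟨m, rfl⟩ : ∃ m, n = 2 * m + 1 := ⟨n / 2, by omega⟩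
  rw [show (2 * m + 1) / 2 = m by omega]
  rw [sum_range_symm_odd fun w hw => by rw [hN w hw, Nat.choose_symm hw]] at hk
  rw [sum_range_symm_odd fun w hw => by rw [hN w hw, choosePred_add_choose_symm hw]] at hp
  exact ⟨z, N, by omega, by omega⟩

theorem IsFirstTypeCOD.exists_components_even (hO : IsFirstTypeCOD O) (hn : n % 2 = 0)
    (hn0 : 0 < n) :
    ∃ (z : ℕ) (t : ℕ → ℕ), (n % 4 = 2 → Even (t (n / 2))) ∧
      p = z + ∑ j ∈ Finset.range (n / 2), t j * (choosePred n j + n.choose (j + 1)) +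
        t (n / 2) * n.choose (n / 2 - 1) ∧
      k = ∑ j ∈ Finset.range (n / 2), t j * n.choose j +
        t (n / 2) * (n - 1).choose (n / 2 - 1) := by
  obtain ⟨z, N, hN, hev, hk, hp⟩ := hO.exists_counts
  refine ⟨z, N, hev, ?_⟩
  obtain ⟨m, rfl⟩ : ∃ m, n = 2 * m := ⟨n / 2, by omega⟩
  have hm : 0 < m := by omega
  rw [Nat.mul_div_cancel_left m two_pos]
  rw [sum_range_symm_even fun w hw => by rw [hN w hw, Nat.choose_symm hw], choose_half hm,
    mul_left_comm] at hk
  rw [sum_range_symm_even fun w hw => by rw [hN w hw, choosePred_add_choose_symm hw],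
    two_mul_choosePred_half hm, mul_left_comm] at hp
  exact ⟨by omega, by omega⟩

theorem IsFirstTypeCOD.exists_components (hO : IsFirstTypeCOD O) (hn : n % 4 ≠ 0) :
    ∃ (z : ℕ) (t : ℕ → ℕ),
      p = z + ∑ j ∈ Finset.range (n / 2 + 1), t j * (choosePred n j + n.choose (j + 1)) ∧
      k = ∑ j ∈ Finset.range (n / 2 + 1), t j * n.choose j := by
  rcases Nat.mod_two_eq_zero_or_one n with h | h
  · obtain ⟨z, t, hev, hp, hk⟩ := hO.exists_components_even h (by omega)
    -- For `n ≡ 2` modulo `4` the even number of half components is regrouped into `s` full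
    -- components of weight `n / 2`.
    obtain ⟨s, hs⟩ := hev (by omega)
    refine ⟨z, Function.update t (n / 2) s, ?_⟩
    have hne : ∀ F : ℕ → ℕ, ∑ j ∈ Finset.range (n / 2), Function.update t (n / 2) s j * F j =
        ∑ j ∈ Finset.range (n / 2), t j * F j := fun F => Finset.sum_congr rfl fun j hj => by
      rw [Function.update_of_ne (Finset.mem_range.mp hj).ne]
    rw [Finset.sum_range_succ, Finset.sum_range_succ,
      hne fun j => choosePred n j + n.choose (j + 1), hne fun j => n.choose j,
      Function.update_self, hp, hk, hs]
    obtain ⟨m, rfl⟩ : ∃ m, n = 2 * m := ⟨n / 2, by omega⟩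
    rw [Nat.mul_div_cancel_left m two_pos, two_mul_choosePred_half (by omega),
      choose_half (by omega)]
    constructor <;> ring
  · exact hO.exists_components_odd h

theorem sum_Icc_neg_one (F : ℤ → ℕ) (M : ℕ) :
    ∑ i ∈ Finset.Icc (-1 : ℤ) ((M : ℤ) - 1), F i = F (-1) + ∑ j ∈ Finset.range M, F j := by
  induction M with
  | zero => simp
  | succ M ih =>
    have h : Finset.Icc (-1 : ℤ) (((M + 1 : ℕ) : ℤ) - 1) =
        insert (M : ℤ) (Finset.Icc (-1 : ℤ) ((M : ℤ) - 1)) := by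
      ext x
      simp only [Finset.mem_insert, Finset.mem_Icc]
      push_cast
      omega
    rw [h, Finset.sum_insert (by simp), ih, Finset.sum_range_succ]
    ring

theorem intChoose_sub_one_add (n j : ℕ) :
    intChoose n ((j : ℤ) - 1) + intChoose n ((j : ℤ) + 1) =
      choosePred n j + n.choose (j + 1) := by
  congr 1
  rcases j with _ | j <;> simp [intChoose, choosePred]

theorem intChoose_natCast (n j : ℕ) : intChoose n (j : ℤ) = n.choose j := by
  simp [intChoose]

/-- At index `-1` the coefficient is `C(n, -2) + C(n, 0) = 1`, with no variables attached: `t (-1)`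
counts zero rows. -/
theorem sum_Icc_rows (t : ℤ → ℕ) (n M : ℕ) :
    ∑ i ∈ Finset.Icc (-1 : ℤ) ((M : ℤ) - 1), t i * (intChoose n (i - 1) + intChoose n (i + 1)) =
      t (-1) + ∑ j ∈ Finset.range M, t j * (choosePred n j + n.choose (j + 1)) := by
  rw [sum_Icc_neg_one]
  simp only [intChoose_sub_one_add]
  simp [intChoose]

theorem sum_Icc_vars (t : ℤ → ℕ) (n M : ℕ) :
    ∑ i ∈ Finset.Icc (-1 : ℤ) ((M : ℤ) - 1), t i * intChoose n i =
      ∑ j ∈ Finset.range M, t j * n.choose j := by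
  rw [sum_Icc_neg_one]
  simp only [intChoose_natCast]
  simp [intChoose]

end Parameters

/-! ### The two cases of the theorem -/

theorem mainTheorem1 (p n k : ℕ) (hp : 0 < p) (hn : 0 < n) (hk : 0 < k) :
    (n % 4 ≠ 0 →
      ((∃ O : Matrix (Fin p) (Fin n) (CODRing k), IsFirstTypeCOD O) ↔
        ∃ t : ℤ → ℕ,
          p = ∑ i ∈ Finset.Icc (-1 : ℤ) ((n / 2 : ℕ) : ℤ),
                t i * (intChoose n (i - 1) + intChoose n (i + 1)) ∧
          k = ∑ i ∈ Finset.Icc (-1 : ℤ) ((n / 2 : ℕ) : ℤ), t i * intChoose n i)) ∧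
    (n % 4 = 0 →
      ((∃ O : Matrix (Fin p) (Fin n) (CODRing k), IsFirstTypeCOD O) ↔
        ∃ t : ℤ → ℕ,
          p = (∑ i ∈ Finset.Icc (-1 : ℤ) (((n / 2 : ℕ) : ℤ) - 1),
                t i * (intChoose n (i - 1) + intChoose n (i + 1))) +
              t ((n / 2 : ℕ) : ℤ) * n.choose (n / 2 - 1) ∧
          k = (∑ i ∈ Finset.Icc (-1 : ℤ) (((n / 2 : ℕ) : ℤ) - 1), t i * intChoose n i) +
              t ((n / 2 : ℕ) : ℤ) * (n - 1).choose (n / 2 - 1))) := by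
  -- Glues the number of zero rows, at index `-1`, to the component multiplicities.
  have hext : ∀ (z : ℕ) (t : ℕ → ℕ), ∃ s : ℤ → ℕ, s (-1) = z ∧ ∀ j : ℕ, s j = t j :=
    fun z t => ⟨fun i => if i = -1 then z else t i.toNat, by simp, fun j => by
      have : (j : ℤ) ≠ -1 := by omega
      simp [this]⟩
  refine ⟨fun h4 => ?_, fun h4 => ?_⟩
  · rw [show ((n / 2 : ℕ) : ℤ) = ((n / 2 + 1 : ℕ) : ℤ) - 1 by push_cast; ring]
    simp only [sum_Icc_rows, sum_Icc_vars]
    constructor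
    · rintro ⟨O, hO⟩
      obtain ⟨z, t, hp', hk'⟩ := hO.exists_components h4
      obtain ⟨s, hs, hs'⟩ := hext z t
      exact ⟨s, by simpa only [hs, hs'] using hp', by simpa only [hs'] using hk'⟩
    · rintro ⟨t, hp', hk'⟩
      exact exists_isFirstTypeCOD_of_components hn (M := n / 2 + 1) (h := 0) (z := t (-1))
        (t := fun j => t j) (fun j hj => by omega) (Or.inl rfl) (by rw [hp']; ring)
        (by rw [hk']; ring)
  · simp only [sum_Icc_rows, sum_Icc_vars]
    constructor
    · rintro ⟨O, hO⟩
      obtain ⟨z, t, -, hp', hk'⟩ := hO.exists_components_even (by omega) hn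
      obtain ⟨s, hs, hs'⟩ := hext z t
      exact ⟨s, by simpa only [hs, hs'] using hp', by simpa only [hs'] using hk'⟩
    · rintro ⟨t, hp', hk'⟩
      exact exists_isFirstTypeCOD_of_components hn (M := n / 2) (h := t ((n / 2 : ℕ) : ℤ))
        (z := t (-1)) (t := fun j => t j) (fun j hj => by omega) (Or.inr h4) hp' hk'
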